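/- **Setting.** For weights $\gamma=(\gamma_{\mathfrak u})_{\mathfrak u\subset\mathbb N,\,|\mathfrak u|<\infty}$ with $\gamma_{\mathfrak u}\ge 0$ and $\gamma_\emptyset=1$, and $\alpha>1$, put $r(\boldsymbol 0,\gamma)=1$ and $r(\boldsymbol h,\gamma)=\gamma_{\mathrm{supp}(\boldsymbol h)}^{-1}\prod_{j\in\mathrm{supp}(\boldsymbol h)}|h_j|^{\alpha}$ for $\boldsymbol 0\ne\boldsymbol h\in\mathbb Z^d$, where $\mathrm{supp}(\boldsymbol h)=\{j: h_j\neq0\}$. Let $\mathcal N_{\mathrm{kor},\alpha}$ and $\mathcal N_{\widetilde{\mathrm{kor}},\alpha}$ be the reproducing kernel Hilbert spaces of real $1$-periodic functions on $\mathbb R^d$ with the kernels $$K(\boldsymbol x,\boldsymbol x')=\sum_{\boldsymbol h\in\mathbb Z^d}r(\boldsymbol h,\gamma)^{-1}e^{2\pi i\boldsymbol h\cdot(\boldsymbol x-\boldsymbol x')},\qquad \widetilde K(\boldsymbol x,\boldsymbol x')=\sum_{\boldsymbol h\in\mathbb Z^d}r(\boldsymbol h,\gamma)^{-2}e^{2\pi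 i\boldsymbol h\cdot(\boldsymbol x-\boldsymbol x')},$$ whose norms are $\|v\|_{\mathrm{kor},\alpha}^2=\sum_{\boldsymbol h}r(\boldsymbol h,\gamma)|\hat v(\boldsymbol h)|^2$ and $\|v\|_{\widetilde{\mathrm{kor}},\alpha}^2=\sum_{\boldsymbol h}r(\boldsymbol h,\gamma)^2|\hat v(\boldsymbol h)|^2$ (with $\hat v(\boldsymbol h)=0$ wherever $\gamma_{\mathrm{supp}(\boldsymbol h)}=0$). For a prime $N$ let $\boldsymbol x_k=\{k\boldsymbol z/N\}$, $k=1,\dots,N$ (componentwise fractional parts), be the rank-1 lattice points of a generating vector $\boldsymbol z\in\{1,\dots,N-1\}^d$ produced by the component-by-component (CBC) construction: for $s=1,\dots,d$ in turn, with $z_1,\dots,z_{s-1}$ fixed, $z_s\in\{1,\dots,N-1\}$ minimizes $$T_{d,s}(z_1,\dots,z_s)=\sum_{\boldsymbol h\in\mathbb Z^d}\ \sum_{\substack{\boldsymbol\ell\in\mathbb Z^d:\ \boldsymbol\ell\cdot\boldsymbol z\equiv0\ (\mathrm{mod}\ N),\\ \ell_s\ne0,\ \ell_j=0\ (j>s)}}\frac{1}{r(\boldsymbol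 h,\gamma)\,r(\boldsymbol h+\boldsymbol\ell,\gamma)} .$$ Let $V_N=\mathrm{span}\{K(\boldsymbol x_k,\cdot):1\le k\le N\}$. Let $Y_1,\dots,Y_M$ be independent random variables with density $f$ on $[0,1]^d$, let $\lambda>0$, and let $f^\lambda_{M,N;\boldsymbol Y}\in V_N$ be the solution of $$\langle f^\lambda_{M,N;\boldsymbol Y},v\rangle_{L^2([0,1]^d)}+\lambda\langle f^\lambda_{M,N;\boldsymbol Y},v\rangle_{\mathrm{kor},\alpha}=\frac1M\sum_{m=1}^M v(Y_m)\qquad\text{for all }v\in V_N .$$ **Theorem.** Let $\alpha>1$, $\delta\in(0,\alpha/4)$, $\tau\in(1/\alpha,1]$, and let the weights be as above. There are constants $C_d,\widetilde C_d>0$ $(d\ge1)$ depending only on $\alpha,\delta,\tau,d$ and the weights such that, for all $d\ge1$, all primes $N$, all CBC vectors $\boldsymbol z$, all $M\ge1$, all $\lambda>0$ and all probability densities $f\in\mathcal N_{\mathrm{kor},\alpha}$, $$\mathbb E\Bigl[\int_{[0,1]^d}|f^\lambda_{M,N;\boldsymbol Y}-f|^2\,d\boldsymbol x\Bigr]\le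 C_d\Bigl(\frac{\|f\|_{\mathrm{kor},\alpha}^2}{N^{\alpha/2-2\delta}}+\lambda\|f\|_{\mathrm{kor},\alpha}^2+\frac{\|f\|_{L^2([0,1]^d)}}{M\lambda^\tau}\Bigr),$$ and, if moreover $f\in\mathcal N_{\widetilde{\mathrm{kor}},\alpha}$, $$\mathbb E\Bigl[\int_{[0,1]^d}|f^\lambda_{M,N;\boldsymbol Y}-f|^2\,d\boldsymbol x\Bigr]\le \widetilde C_d\Bigl(\frac{\|f\|_{\mathrm{kor},\alpha}^2}{N^{\alpha/2-2\delta}}+\lambda^2\|f\|_{\widetilde{\mathrm{kor}},\alpha}^2+\frac{\|f\|_{L^2([0,1]^d)}}{M\lambda^\tau}\Bigr).$$ The constants can be chosen such that the following holds, where $\zeta$ is the Riemann zeta function and (S) is the condition $\sum_{|\mathfrak u|<\infty}\gamma_{\mathfrak u}^{\tau}[2\zeta(\alpha\tau)]^{|\mathfrak u|}<\infty$. * $\sup_d C_d<\infty$, provided that $$\sum_{\mathfrak u\subset\mathbb N,\,|\mathfrak u|<\infty}\max(|\mathfrak u|,1)\,\gamma_{\mathfrak u}^{\frac1{\alpha-4\delta}}\Bigl[2\zeta\bigl(\tfrac{\alpha}{\alpha-4\delta}\bigr)\Bigr]^{|\mathfrak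 u|}<\infty$$ and that $\tau\ge\frac1{\alpha-4\delta}$ or, for smaller $\tau$, (S) holds. * $\sup_d\widetilde C_d<\infty$, provided that the analogous condition for $\widetilde K$ (smoothness $2\alpha$, weights $\gamma_{\mathfrak u}^2$), $$\sum_{\mathfrak u\subset\mathbb N,\,|\mathfrak u|<\infty}\max(|\mathfrak u|,1)\,(\gamma_{\mathfrak u}^2)^{\frac1{2\alpha-4\delta}}\Bigl[2\zeta\bigl(\tfrac{2\alpha}{2\alpha-4\delta}\bigr)\Bigr]^{|\mathfrak u|}<\infty,$$ holds and that $\tau\ge\frac1{\alpha-2\delta}$ or, for smaller $\tau$, (S) holds. -/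

import Mathlib

universe u

namespace KorobovDensity

open MeasureTheory ProbabilityTheory

noncomputable section

/-- The unit cube `[0,1]^d`. -/
def cube (d : ℕ) : Set (Fin d → ℝ) := Set.Icc 0 1

/-- The trigonometric monomial `x ↦ exp (2 π i h · x)`. -/
def trig {d : ℕ} (h : Fin d → ℤ) (x : Fin d → ℝ) : ℂ :=
  Complex.exp (2 * Real.pi * Complex.I * ((∑ j, (h j : ℝ) * x j : ℝ) : ℂ))

/-- The Fourier coefficient `∫_{[0,1]^d} f(x) exp (-2 π i h · x) dx`. -/
def fourierCoef {d : ℕ} (f : (Fin d → ℝ) → ℝ) (h : Fin d → ℤ) : ℂ :=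
  ∫ x in cube d, (f x : ℂ) * trig (-h) x

/-- The support `{j | h j ≠ 0}`. -/
def supp {d : ℕ} (h : Fin d → ℤ) : Finset (Fin d) :=
  Finset.univ.filter fun j => h j ≠ 0

/-- The reciprocal `r(h,γ)⁻¹ = γ_{supp h} ∏_{j ∈ supp h} |h_j|^{-α}`; it is `γ ∅` at `h = 0`, and it
vanishes where the weight does (that is, where `r(h,γ) = ∞`). Coordinates are numbered `0, …, d-1`,
so that the weights are indexed by the finite subsets of `ℕ = {0, 1, …}`. -/
def rInv {d : ℕ} (α : ℝ) (γ : Finset ℕ → ℝ) (h : Fin d → ℤ) : ℝ :=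
  γ ((supp h).map Fin.valEmbedding) * ∏ j ∈ supp h, |(h j : ℝ)| ^ (-α)

/-- The kernel `K(x,x') = ∑_{h ∈ ℤ^d} ρ(h) exp (2 π i h · (x - x'))`, for a family `ρ ≥ 0` that is
summable and even (so that the sum is real). The Korobov kernel is the case `ρ = rInv α γ`, and the
kernel with the coefficients `r(h,γ)⁻²` is the case `ρ = (rInv α γ)^2`. -/
def kernel {d : ℕ} (ρ : (Fin d → ℤ) → ℝ) (x x' : Fin d → ℝ) : ℝ :=
  (∑' h : Fin d → ℤ, (ρ h : ℂ) * trig h (x - x')).re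

/-- Membership in the reproducing kernel Hilbert space of `kernel ρ`: continuous real functions on
`ℝ^d`, `1`-periodic in each variable, with `∑_h ρ(h)⁻¹ |f̂(h)|² < ∞`, where a term with `ρ(h) = 0`
means that `f̂(h) = 0`. -/
structure MemRKHS {d : ℕ} (ρ : (Fin d → ℤ) → ℝ) (f : (Fin d → ℝ) → ℝ) : Prop where
  continuous : Continuous f
  periodic : ∀ (n : Fin d → ℤ) (x : Fin d → ℝ), f (fun j => x j + n j) = f x
  coef_eq_zero : ∀ h, ρ h = 0 → fourierCoef f h = 0
  summable : Summable fun h => ‖fourierCoef f h‖ ^ 2 / ρ h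

/-- The inner product of that space. -/
def rkhsInner {d : ℕ} (ρ : (Fin d → ℤ) → ℝ) (f g : (Fin d → ℝ) → ℝ) : ℝ :=
  ∑' h : Fin d → ℤ, (fourierCoef f h * (starRingEnd ℂ) (fourierCoef g h)).re / ρ h

/-- The norm of that space. -/
def rkhsNorm {d : ℕ} (ρ : (Fin d → ℤ) → ℝ) (f : (Fin d → ℝ) → ℝ) : ℝ :=
  Real.sqrt (∑' h : Fin d → ℤ, ‖fourierCoef f h‖ ^ 2 / ρ h)

/-- The inner product of `L²([0,1]^d)`. -/
def l2Inner {d : ℕ} (f g : (Fin d → ℝ) → ℝ) : ℝ := ∫ x in cube d, f x * g x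

/-- The norm of `L²([0,1]^d)`. -/
def l2Norm {d : ℕ} (f : (Fin d → ℝ) → ℝ) : ℝ := Real.sqrt (∫ x in cube d, f x ^ 2)

/-- The rank-1 lattice points `x_k = {k z / N}`, `k = 1, …, N`. -/
def latticePoint {d : ℕ} (N : ℕ) (z : Fin d → ℕ) (k : Fin N) : Fin d → ℝ :=
  fun j => Int.fract ((((k : ℕ) + 1 : ℕ) : ℝ) * (z j : ℝ) / (N : ℝ))

/-- The space `V_N` spanned by the functions `K(x_k, ·)`, `k = 1, …, N`. -/
def approxSpace {d : ℕ} (ρ : (Fin d → ℤ) → ℝ) (N : ℕ) (z : Fin d → ℕ) :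
    Submodule ℝ ((Fin d → ℝ) → ℝ) :=
  Submodule.span ℝ (Set.range fun k : Fin N => kernel ρ (latticePoint N z k))

/-- `g` is the kernel estimator for the data `y_1, …, y_M`: the element of `V_N` such that
`⟨g, v⟩_{L²} + λ ⟨g, v⟩_K = (1/M) ∑_m v(y_m)` for all `v ∈ V_N`. -/
def IsEstimator {d M : ℕ} (ρ : (Fin d → ℤ) → ℝ) (N : ℕ) (z : Fin d → ℕ) (lam : ℝ)
    (y : Fin M → Fin d → ℝ) (g : (Fin d → ℝ) → ℝ) : Prop :=
  g ∈ approxSpace ρ N z ∧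
    ∀ v ∈ approxSpace ρ N z,
      l2Inner g v + lam * rkhsInner ρ g v = (1 / (M : ℝ)) * ∑ m, v (y m)

/-- The part of the lattice quality measure
`S_d(z) = ∑_{h ∈ ℤ^d} ∑_{0 ≠ ℓ ∈ ℤ^d, ℓ·z ≡ 0 mod N} r(h)⁻¹ r(h+ℓ)⁻¹` that comes from those `ℓ`
whose last nonzero coordinate is the `s`-th one. It depends on the coordinates of `z` up to the
`s`-th only, and the sum of these parts over all `s` is `S_d(z)`. -/
def cbcCriterion {d : ℕ} (ρ : (Fin d → ℤ) → ℝ) (N : ℕ) (s : Fin d) (z : Fin d → ℕ) : ℝ :=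
  open Classical in
  ∑' p : (Fin d → ℤ) × (Fin d → ℤ),
    if p.2 s ≠ 0 ∧ (∀ j, s < j → p.2 j = 0) ∧ (N : ℤ) ∣ ∑ j, p.2 j * (z j : ℤ) then
      ρ p.1 * ρ (p.1 + p.2)
    else 0

/-- `z` is an output of the component-by-component construction: for `s = 1, …, d` in turn, with
`z_1, …, z_{s-1}` kept fixed, `z_s` minimizes the `s`-th part of the criterion over
`{1, …, N-1}`. -/
def IsCBC {d : ℕ} (ρ : (Fin d → ℤ) → ℝ) (N : ℕ) (z : Fin d → ℕ) : Prop :=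
  (∀ s, z s ∈ Finset.Icc 1 (N - 1)) ∧
    ∀ s, ∀ a ∈ Finset.Icc 1 (N - 1),
      cbcCriterion ρ N s z ≤ cbcCriterion ρ N s (Function.update z s a)

/-- The random variables `Y_1, …, Y_M` are independent, each with density `f` with respect to the
uniform measure on `[0,1]^d`. -/
structure IsSample {d M : ℕ} {Ω : Type u} [MeasurableSpace Ω] (P : Measure Ω)
    (f : (Fin d → ℝ) → ℝ) (Y : Fin M → Ω → Fin d → ℝ) : Prop where
  measurable : ∀ m, Measurable (Y m)
  indep : iIndepFun Y P
  law : ∀ m, P.map (Y m) = (volume.restrict (cube d)).withDensity fun x => ENNReal.ofReal (f x)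

/-- The mean integrated squared error `𝔼 ∫_{[0,1]^d} |fhat(x) - f(x)|² dx`. -/
def mise {d : ℕ} {Ω : Type u} [MeasurableSpace Ω] (P : Measure Ω)
    (fhat : Ω → (Fin d → ℝ) → ℝ) (f : (Fin d → ℝ) → ℝ) : ENNReal :=
  ∫⁻ ω, (∫⁻ x in cube d, ENNReal.ofReal (|fhat ω x - f x| ^ 2)) ∂P

/-- The condition
`∑_{𝔲 ⊂ ℕ, |𝔲| < ∞} max(|𝔲|,1) γ_𝔲^{1/(α-4δ)} [2 ζ(α/(α-4δ))]^{|𝔲|} < ∞`. -/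
def WeightSummable (α δ : ℝ) (γ : Finset ℕ → ℝ) : Prop :=
  Summable fun w : Finset ℕ =>
    max (w.card : ℝ) 1 * γ w ^ (1 / (α - 4 * δ)) *
      (2 * (riemannZeta ((α / (α - 4 * δ) : ℝ) : ℂ)).re) ^ w.card

/-- The condition `∑_{𝔲 ⊂ ℕ, |𝔲| < ∞} γ_𝔲^τ [2 ζ(ατ)]^{|𝔲|} < ∞`, which says that
`∑_{h ∈ ℤ^d} r(h,γ)^{-τ}` is bounded in `d`. -/
def TraceSummable (α τ : ℝ) (γ : Finset ℕ → ℝ) : Prop :=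
  Summable fun w : Finset ℕ =>
    γ w ^ τ * (2 * (riemannZeta ((α * τ : ℝ) : ℂ)).re) ^ w.card

end

end KorobovDensity

/-! Write `ρ = 1/r` and `A = ⟨·,·⟩_{L²} + λ⟨·,·⟩_K`. The error is split at the regularized
projection `u ∈ V_N` of `f`, defined by `A(u,v) = ⟨f,v⟩_{L²}` on `V_N`.

Variance (`mise_le`). In an `A`-orthonormal basis `φ_i` of `V_N`, the estimator minus `u` has
centred sample means as coefficients, so its mean squared `A`-norm is at most `M⁻¹ ∫ f ∑ φ_i²`. Here
`∑ φ_i(x)²` is the squared `A`-norm of evaluation at `x` on `V_N`, hence at most `∑ ρ/(ρ+λ) ≤ λ^{-τ}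
∑ ρ^τ` (`MemRKHS.sq_le`, `tsum_div_add_le`). A probability density on the cube has `L²` norm at
least 1, which allows the factor `‖f‖_{L²}`.

Bias (`l2Inner_bias_le`). Compare `u` with the kernel interpolant `p` of `f`. As `q = f - p`
vanishes at the lattice points, `q̂(h)` is minus the sum of `q̂(h+l)` over the nonzero dual lattice,
and Cauchy-Schwarz gives `|q̂(h)|² ≤ ‖q‖_K² ∑_l ρ(h+l)`. This is used where `ρ(h)` is large, and
`|q̂(h)|² = ρ(h)·|q̂(h)|²/ρ(h)` where it is small. With threshold `1/m` the result is `‖q‖² ≤ (1/m +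
m S)‖q‖_K²`, of order `√S` for the best `m`, where `S` is the lattice quality. Regularization costs
`λ‖f‖_K²`, or `λ²` times the squared smoother norm.

Lattice (`latticeQuality_rpow_le`). Averaging over each component gives `S^μ ≤ (c/N)(∑ ρ^μ)²`, with
`c` depending on `αμ` only. No factor `d` appears, because two distinct frequencies have exactly one
last coordinate of difference. So the dimension enters only through the traces `∑ ρ^μ` and `∑ ρ^τ`,
which the weight conditions bound uniformly. A single constant, `errorConst`, serves both error
bounds. -/

namespace KorobovDensity

open MeasureTheory ProbabilityTheory

noncomputable section

/-! ### Fourier series of periodic functions on `ℝ^d`, transported from the torus. -/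

section Fourier

open UnitAddTorus

-- Normalized Haar measure makes the characters orthonormal and matches Lebesgue measure on the unit
-- cube.
local instance instMeasureSpaceCircle : MeasureSpace UnitAddCircle := ⟨AddCircle.haarAddCircle⟩

local instance instHaarCircle : Measure.IsAddHaarMeasure (volume : Measure UnitAddCircle) :=
  inferInstanceAs (Measure.IsAddHaarMeasure AddCircle.haarAddCircle)

local instance instProbCircle : IsProbabilityMeasure (volume : Measure UnitAddCircle) :=
  inferInstanceAs (IsProbabilityMeasure AddCircle.haarAddCircle)

variable {d : ℕ}

/-- The projection from `ℝ^d` to the torus. -/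
def toTorus (x : Fin d → ℝ) : UnitAddTorus (Fin d) := fun j => (x j : UnitAddCircle)

lemma trig_eq_mFourier (h : Fin d → ℤ) (x : Fin d → ℝ) : trig h x = mFourier h (toTorus x) := by
  simp only [trig, mFourier, toTorus, ContinuousMap.coe_mk, fourier_coe_apply]
  rw [← Complex.exp_sum]
  congr 1
  push_cast
  rw [Finset.mul_sum]
  refine Finset.sum_congr rfl fun j _ => ?_
  simp
  ring

lemma isOpenQuotientMap_toTorus : IsOpenQuotientMap (toTorus (d := d)) :=
  IsOpenQuotientMap.piMap (f := fun (_ : Fin d) (x : ℝ) => (x : UnitAddCircle))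
    fun _ => QuotientAddGroup.isOpenQuotientMap_mk

lemma continuous_trig (h : Fin d → ℤ) : Continuous (trig h) := by
  unfold trig
  fun_prop

lemma norm_trig (h : Fin d → ℤ) (x : Fin d → ℝ) : ‖trig h x‖ = 1 := by
  rw [trig, show (2 * Real.pi * Complex.I * ((∑ j, (h j : ℝ) * x j : ℝ) : ℂ) : ℂ)
    = ((2 * Real.pi * ∑ j, (h j : ℝ) * x j : ℝ) : ℂ) * Complex.I by push_cast; ring]
  exact Complex.norm_exp_ofReal_mul_I _

lemma trig_add_left (h k : Fin d → ℤ) (x : Fin d → ℝ) :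
    trig (h + k) x = trig h x * trig k x := by
  simp_rw [trig_eq_mFourier]
  exact mFourier_add

lemma trig_neg_left (h : Fin d → ℤ) (x : Fin d → ℝ) :
    trig (-h) x = (starRingEnd ℂ) (trig h x) := by
  simp_rw [trig_eq_mFourier]
  exact mFourier_neg

lemma trig_sub_right (h : Fin d → ℤ) (x y : Fin d → ℝ) :
    trig h (x - y) = trig h x * trig (-h) y := by
  rw [trig, trig, trig, ← Complex.exp_add]
  congr 1
  push_cast
  rw [← mul_add, ← Finset.sum_add_distrib]
  congr 1
  refine Finset.sum_congr rfl fun j _ => ?_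
  simp
  ring

lemma trig_add_int (h n : Fin d → ℤ) (x : Fin d → ℝ) :
    trig h (fun j => x j + n j) = trig h x := by
  rw [trig_eq_mFourier, trig_eq_mFourier]
  congr 1
  ext j
  simp only [toTorus]
  rw [AddCircle.coe_add]
  have : ((n j : ℝ) : UnitAddCircle) = 0 := by
    rw [AddCircle.coe_eq_zero_iff]
    exact ⟨n j, by simp⟩
  rw [this, add_zero]

/-- Periodicity makes `f` constant on the fibres of `toTorus`, and continuity descends because
`toTorus` is a quotient map. -/
lemma exists_torus_lift {f : (Fin d → ℝ) → ℝ} (hf : Continuous f)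
    (hp : ∀ (n : Fin d → ℤ) (x : Fin d → ℝ), f (fun j => x j + n j) = f x) :
    ∃ F : C(UnitAddTorus (Fin d), ℂ), ∀ x, F (toTorus x) = (f x : ℂ) := by
  have key : ∀ x y : Fin d → ℝ, toTorus x = toTorus y → (f x : ℂ) = f y := by
    intro x y hxy
    have h1 : ∀ j, ∃ n : ℤ, x j = y j + n := by
      intro j
      have h2 : ((x j : ℝ) : UnitAddCircle) = (y j : UnitAddCircle) := congrFun hxy j
      have h3 : ((x j - y j : ℝ) : UnitAddCircle) = 0 := by
        rw [AddCircle.coe_sub, h2, sub_self]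
      obtain ⟨n, hn⟩ := (AddCircle.coe_eq_zero_iff _).1 h3
      refine ⟨n, ?_⟩
      simp at hn
      linarith
    choose n hn using h1
    have : x = fun j => y j + n j := funext hn
    rw [this, hp]
  let Q : (UnitAddTorus (Fin d)) → ℂ := fun t => (f (Function.surjInv
    (isOpenQuotientMap_toTorus (d := d)).surjective t) : ℂ)
  have hQ : ∀ x, Q (toTorus x) = (f x : ℂ) := fun x =>
    key _ _ (Function.surjInv_eq (isOpenQuotientMap_toTorus (d := d)).surjective _)
  refine ⟨⟨Q, ?_⟩, hQ⟩
  rw [(isOpenQuotientMap_toTorus (d := d)).isQuotientMap.continuous_iff]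
  have : Q ∘ toTorus = fun x => (f x : ℂ) := funext hQ
  rw [this]
  fun_prop

lemma integral_torus {E : Type*} [NormedAddCommGroup E] [NormedSpace ℝ E]
    (G : UnitAddTorus (Fin d) → E) :
    ∫ t, G t = ∫ x in cube d, G (toTorus x) := by
  rw [integral_preimage G 0]
  -- The half-open fundamental domain and the closed cube differ by a null set.
  refine setIntegral_congr_set ?_
  have h := Measure.univ_pi_Ioc_ae_eq_Icc (μ := fun _ : Fin d => (volume : Measure ℝ))
    (f := 0) (g := 1)
  have h2 : {x : Fin d → ℝ | ∀ i, x i ∈ Set.Ioc ((0 : Fin d → ℝ) i) ((0 : Fin d → ℝ) i + 1)}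
      = Set.pi Set.univ fun i => Set.Ioc ((0 : Fin d → ℝ) i) ((1 : Fin d → ℝ) i) := by
    ext x
    simp
  rw [h2]
  exact h

lemma mFourierCoeff_eq_fourierCoef {f : (Fin d → ℝ) → ℝ} {F : UnitAddTorus (Fin d) → ℂ}
    (hF : ∀ x, F (toTorus x) = (f x : ℂ)) (h : Fin d → ℤ) :
    mFourierCoeff F h = fourierCoef f h := by
  rw [mFourierCoeff, fourierCoef]
  refine (integral_torus _).trans ?_
  simp_rw [hF, trig_eq_mFourier, smul_eq_mul, mul_comm]

/-- Fourier inversion for continuous periodic functions with summable Fourier coefficients. -/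
lemma hasSum_fourier {f : (Fin d → ℝ) → ℝ} (hf : Continuous f)
    (hp : ∀ (n : Fin d → ℤ) (x : Fin d → ℝ), f (fun j => x j + n j) = f x)
    (hs : Summable fun h => ‖fourierCoef f h‖) (x : Fin d → ℝ) :
    HasSum (fun h => fourierCoef f h * trig h x) (f x : ℂ) := by
  obtain ⟨F, hF⟩ := exists_torus_lift hf hp
  have hs' : Summable (mFourierCoeff F) := by
    refine Summable.of_norm ?_
    simpa only [mFourierCoeff_eq_fourierCoef hF] using hs
  have := hasSum_mFourier_series_apply_of_summable hs' (toTorus x)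
  simpa only [mFourierCoeff_eq_fourierCoef hF, hF, smul_eq_mul, ← trig_eq_mFourier] using this

/-- Parseval's identity for continuous periodic functions. -/
lemma hasSum_sq_fourierCoef {f : (Fin d → ℝ) → ℝ} (hf : Continuous f)
    (hp : ∀ (n : Fin d → ℤ) (x : Fin d → ℝ), f (fun j => x j + n j) = f x) :
    HasSum (fun h => ‖fourierCoef f h‖ ^ 2) (l2Inner f f) := by
  obtain ⟨F, hF⟩ := exists_torus_lift hf hp
  have h1 := hasSum_sq_mFourierCoeff (F.toLp (E := ℂ) 2 volume ℂ)
  simp only [mFourierCoeff_toLp, mFourierCoeff_eq_fourierCoef hF] at h1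
  convert h1 using 1
  have h2 : ∫ t, ‖(F.toLp (E := ℂ) 2 volume ℂ) t‖ ^ 2 = ∫ t, ‖F t‖ ^ 2 := by
    refine integral_congr_ae ?_
    filter_upwards [F.coeFn_toLp (p := 2) (𝕜 := ℂ) volume] with t ht
    rw [ht]
  rw [h2, integral_torus, l2Inner]
  simp only [hF, Complex.norm_real, Real.norm_eq_abs, sq_abs]
  simp only [sq]

/-- The Fourier coefficients of an absolutely convergent trigonometric series. -/
lemma fourierCoef_of_hasSum {f : (Fin d → ℝ) → ℝ} {c : (Fin d → ℤ) → ℂ}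
    (hc : Summable fun h => ‖c h‖) (hf : ∀ x, (f x : ℂ) = ∑' h, c h * trig h x)
    (k : Fin d → ℤ) : fourierCoef f k = c k := by
  have hG : Summable fun h => c h • (mFourier h : C(UnitAddTorus (Fin d), ℂ)) := by
    refine Summable.of_norm ?_
    simpa only [norm_smul, mFourier_norm, mul_one] using hc
  obtain ⟨G, hG⟩ := hG
  have hGx : ∀ x, G (toTorus x) = (f x : ℂ) := by
    intro x
    have h1 : HasSum (fun h => c h • mFourier h (toTorus x)) (G (toTorus x)) := by
      simpa only [map_smul] using! (ContinuousMap.evalCLM ℂ (toTorus x)).hasSum hG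
    rw [hf, ← h1.tsum_eq]
    simp only [smul_eq_mul, trig_eq_mFourier]
  rw [← mFourierCoeff_eq_fourierCoef hGx, ← mFourierCoeff_toLp, ← mFourierBasis_repr,
    HilbertBasis.repr_apply_apply, coe_mFourierBasis]
  have h2 := (innerSL ℂ (mFourierLp (d := Fin d) 2 k)).hasSum
    ((ContinuousMap.toLp (E := ℂ) 2 volume ℂ).hasSum hG)
  simp only [map_smul, innerSL_apply_apply, smul_eq_mul] at h2
  rw [← h2.tsum_eq, tsum_eq_single k]
  · have := (orthonormal_iff_ite.1 (orthonormal_mFourier (d := Fin d))) k k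
    simp only [if_true] at this
    rw [this, mul_one]
  · intro h hh
    have := (orthonormal_iff_ite.1 (orthonormal_mFourier (d := Fin d))) k h
    rw [if_neg hh.symm] at this
    rw [this, mul_zero]

lemma continuous_of_hasSum {f : (Fin d → ℝ) → ℝ} {c : (Fin d → ℤ) → ℂ}
    (hc : Summable fun h => ‖c h‖) (hf : ∀ x, (f x : ℂ) = ∑' h, c h * trig h x) :
    Continuous f := by
  have h1 : Continuous fun x => ∑' h, c h * trig h x :=
    continuous_tsum (fun h => continuous_const.mul (continuous_trig h)) hc
      fun h x => by rw [norm_mul, norm_trig, mul_one]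
  have h2 : f = fun x => (∑' h, c h * trig h x).re := by
    ext x
    rw [← hf, Complex.ofReal_re]
  rw [h2]
  exact Complex.continuous_re.comp h1

end Fourier

/-! ### Positive semidefinite forms on a subspace. -/

section Forms

variable {X : Type*} [AddCommGroup X] [Module ℝ X]

/-- `B` is symmetric, bilinear and positive semidefinite on the subspace `V`. -/
structure IsPosForm (V : Submodule ℝ X) (B : X → X → ℝ) : Prop where
  symm : ∀ u ∈ V, ∀ v ∈ V, B u v = B v u
  add_left : ∀ u ∈ V, ∀ v ∈ V, ∀ w ∈ V, B (u + v) w = B u w + B v w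
  smul_left : ∀ (c : ℝ), ∀ u ∈ V, ∀ v ∈ V, B (c • u) v = c * B u v
  nonneg : ∀ u ∈ V, 0 ≤ B u u

namespace IsPosForm

variable {V : Submodule ℝ X} {B : X → X → ℝ} (hB : IsPosForm V B)
include hB

lemma mono {W : Submodule ℝ X} (h : W ≤ V) : IsPosForm W B where
  symm u hu v hv := hB.symm u (h hu) v (h hv)
  add_left u hu v hv w hw := hB.add_left u (h hu) v (h hv) w (h hw)
  smul_left c u hu v hv := hB.smul_left c u (h hu) v (h hv)
  nonneg u hu := hB.nonneg u (h hu)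

lemma add_mul {D : X → X → ℝ} (hD : IsPosForm V D) {c : ℝ} (hc : 0 ≤ c) :
    IsPosForm V fun u v => B u v + c * D u v where
  symm u hu v hv := by rw [hB.symm u hu v hv, hD.symm u hu v hv]
  add_left u hu v hv w hw := by
    rw [hB.add_left u hu v hv w hw, hD.add_left u hu v hv w hw]; ring
  smul_left a u hu v hv := by
    rw [hB.smul_left a u hu v hv, hD.smul_left a u hu v hv]; ring
  nonneg u hu := add_nonneg (hB.nonneg u hu) (mul_nonneg hc (hD.nonneg u hu))

lemma add_right {u v w : X} (hu : u ∈ V) (hv : v ∈ V) (hw : w ∈ V) :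
    B w (u + v) = B w u + B w v := by
  rw [hB.symm w hw _ (V.add_mem hu hv), hB.add_left u hu v hv w hw, hB.symm u hu w hw,
    hB.symm v hv w hw]

lemma smul_right (c : ℝ) {u v : X} (hu : u ∈ V) (hv : v ∈ V) : B u (c • v) = c * B u v := by
  rw [hB.symm u hu _ (V.smul_mem c hv), hB.smul_left c v hv u hu, hB.symm v hv u hu]

lemma sub_left {u v w : X} (hu : u ∈ V) (hv : v ∈ V) (hw : w ∈ V) :
    B (u - v) w = B u w - B v w := by
  have := hB.add_left (u - v) (V.sub_mem hu hv) v hv w hw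
  rw [sub_add_cancel] at this
  linarith

lemma sub_right {u v w : X} (hu : u ∈ V) (hv : v ∈ V) (hw : w ∈ V) :
    B w (u - v) = B w u - B w v := by
  rw [hB.symm w hw _ (V.sub_mem hu hv), hB.sub_left hu hv hw, hB.symm u hu w hw,
    hB.symm v hv w hw]

lemma zero_left {v : X} (hv : v ∈ V) : B 0 v = 0 := by
  have := hB.smul_left 0 0 V.zero_mem v hv
  simpa using this

lemma sum_left {ι : Type*} (s : Finset ι) (u : ι → X) (hu : ∀ i, u i ∈ V) {v : X} (hv : v ∈ V) :
    B (∑ i ∈ s, u i) v = ∑ i ∈ s, B (u i) v := by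
  classical
  induction s using Finset.induction_on with
  | empty => simpa using hB.zero_left hv
  | insert i s hi ih =>
    rw [Finset.sum_insert hi, Finset.sum_insert hi,
      hB.add_left _ (hu i) _ (V.sum_mem fun j _ => hu j) _ hv, ih]

lemma sum_smul_left {ι : Type*} (s : Finset ι) (a : ι → ℝ) (u : ι → X) (hu : ∀ i, u i ∈ V)
    {v : X} (hv : v ∈ V) : B (∑ i ∈ s, a i • u i) v = ∑ i ∈ s, a i * B (u i) v := by
  rw [hB.sum_left s _ (fun i => V.smul_mem _ (hu i)) hv]
  exact Finset.sum_congr rfl fun i _ => hB.smul_left _ _ (hu i) _ hv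

lemma two_mul_le {u v : X} (hu : u ∈ V) (hv : v ∈ V) : 2 * B u v ≤ B u u + B v v := by
  have h := hB.nonneg _ (V.sub_mem hu hv)
  rw [hB.sub_left hu hv (V.sub_mem hu hv), hB.sub_right hu hv hu, hB.sub_right hu hv hv,
    hB.symm v hv u hu] at h
  linarith

lemma add_self_le {u v : X} (hu : u ∈ V) (hv : v ∈ V) :
    B (u + v) (u + v) ≤ 2 * B u u + 2 * B v v := by
  have h := hB.two_mul_le hu hv
  rw [hB.add_left u hu v hv _ (V.add_mem hu hv), hB.add_right hu hv hu, hB.add_right hu hv hv,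
    hB.symm v hv u hu]
  linarith

/-- A positive definite form on a finite-dimensional space has an orthonormal basis. -/
lemma exists_orthonormal [FiniteDimensional ℝ V] (hdef : ∀ v ∈ V, B v v = 0 → v = 0) :
    ∃ (n : ℕ) (φ : Fin n → X), (∀ i, φ i ∈ V) ∧ (∀ i j, B (φ i) (φ j) = if i = j then 1 else 0) ∧
      ∀ v ∈ V, v = ∑ i, B v (φ i) • φ i := by
  -- The form itself is installed as an inner product on `V`, so that a standard orthonormal basis
  -- is available. The instances stay local because several forms live on the same space.
  let core : InnerProductSpace.Core ℝ V :=
    { inner := fun u v => B u v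
      conj_inner_symm := fun u v => by simpa using hB.symm v v.2 u u.2
      re_inner_nonneg := fun u => by simpa using hB.nonneg u u.2
      add_left := fun u v w => hB.add_left u u.2 v v.2 w w.2
      smul_left := fun u v c => by simpa using hB.smul_left c u u.2 v v.2
      definite := fun u hu => Subtype.ext (hdef u u.2 hu) }
  let _ : NormedAddCommGroup V := core.toNormedAddCommGroup
  let _ : InnerProductSpace ℝ V := InnerProductSpace.ofCore core.toCore
  let b := stdOrthonormalBasis ℝ V
  have hin : ∀ u v : V, inner ℝ u v = B u v := fun u v => rfl
  refine ⟨_, fun i => (b i : X), fun i => (b i).2, fun i j => ?_, fun v hv => ?_⟩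
  · rw [← hin]
    exact orthonormal_iff_ite.1 b.orthonormal i j
  · have h := b.sum_repr' ⟨v, hv⟩
    have h2 := congrArg (Subtype.val) h
    rw [AddSubmonoidClass.coe_finsetSum] at h2
    refine h2.symm.trans (Finset.sum_congr rfl fun i _ => ?_)
    rw [Submodule.coe_smul, hin, hB.symm _ (b i).2 _ hv]

end IsPosForm

/-- Expansion of a form in an orthonormal family. -/
lemma IsPosForm.self_eq_sum_sq {V : Submodule ℝ X} {B : X → X → ℝ} (hB : IsPosForm V B) {n : ℕ}
    {φ : Fin n → X} (hφ : ∀ i, φ i ∈ V) (hon : ∀ i j, B (φ i) (φ j) = if i = j then 1 else 0)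
    (c : Fin n → ℝ) :
    B (∑ i, c i • φ i) (∑ i, c i • φ i) = ∑ i, c i ^ 2 := by
  have hmem : ∑ i, c i • φ i ∈ V := V.sum_mem fun i _ => V.smul_mem _ (hφ i)
  rw [hB.sum_smul_left _ _ _ hφ hmem]
  refine Finset.sum_congr rfl fun i _ => ?_
  rw [hB.symm _ (hφ i) _ hmem, hB.sum_smul_left _ _ _ hφ (hφ i)]
  simp [hon, sq]

end Forms

/-- A weighted Cauchy-Schwarz inequality for series. -/
lemma summable_and_tsum_sq_le {ι : Type*} {c p w : ι → ℝ} (hc : ∀ i, 0 ≤ c i) (hp : ∀ i, 0 ≤ p i)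
    (hw : ∀ i, 0 ≤ w i) (h : ∀ i, c i ^ 2 ≤ p i * w i) (hps : Summable p) (hws : Summable w) :
    Summable c ∧ (∑' i, c i) ^ 2 ≤ (∑' i, p i) * ∑' i, w i := by
  have hle : ∀ i, c i ≤ √(p i) * √(w i) := fun i => by
    rw [← Real.sqrt_mul (hp i)]
    exact Real.le_sqrt_of_sq_le (h i)
  have h2 : ∀ q : ι → ℝ, (∀ i, 0 ≤ q i) → ∀ i, √(q i) ^ (2 : ℝ) = q i := fun q hq i => by
    rw [Real.rpow_two, Real.sq_sqrt (hq i)]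
  have key := Real.summable_and_inner_le_Lp_mul_Lq_tsum_of_nonneg Real.HolderConjugate.two_two
    (f := fun i => √(p i)) (g := fun i => √(w i)) (fun i => Real.sqrt_nonneg _)
    (fun i => Real.sqrt_nonneg _) (by simpa only [h2 p hp] using hps)
    (by simpa only [h2 w hw] using hws)
  simp only [h2 p hp, h2 w hw] at key
  have hcs : Summable c := Summable.of_nonneg_of_le hc hle key.1
  refine ⟨hcs, ?_⟩
  have h3 : ∑' i, c i ≤ √(∑' i, p i) * √(∑' i, w i) := by
    refine (hcs.tsum_le_tsum hle key.1).trans ?_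
    rw [Real.sqrt_eq_rpow, Real.sqrt_eq_rpow]
    exact key.2
  calc (∑' i, c i) ^ 2 ≤ (√(∑' i, p i) * √(∑' i, w i)) ^ 2 :=
        pow_le_pow_left₀ (tsum_nonneg hc) h3 2
    _ = _ := by rw [mul_pow, Real.sq_sqrt (tsum_nonneg hp), Real.sq_sqrt (tsum_nonneg hw)]

/-! ### The reproducing kernel Hilbert space: forms, point evaluation, kernel. -/

section RKHS

variable {d : ℕ}

lemma isCompact_cube : IsCompact (cube d) := isCompact_Icc

lemma measurableSet_cube : MeasurableSet (cube d) := measurableSet_Icc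

lemma integrableOn_cube {E : Type*} [NormedAddCommGroup E] {f : (Fin d → ℝ) → E}
    (hf : Continuous f) : IntegrableOn f (cube d) :=
  hf.continuousOn.integrableOn_compact isCompact_cube

lemma fourierCoef_add {f g : (Fin d → ℝ) → ℝ} (hf : Continuous f) (hg : Continuous g)
    (h : Fin d → ℤ) : fourierCoef (f + g) h = fourierCoef f h + fourierCoef g h := by
  have ht := continuous_trig (-h)
  rw [fourierCoef, fourierCoef, fourierCoef, ← integral_add]
  · simp only [Pi.add_apply, Complex.ofReal_add, add_mul]
  · exact integrableOn_cube (by fun_prop)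
  · exact integrableOn_cube (by fun_prop)

lemma fourierCoef_smul (c : ℝ) (f : (Fin d → ℝ) → ℝ) (h : Fin d → ℤ) :
    fourierCoef (c • f) h = c * fourierCoef f h := by
  rw [fourierCoef, fourierCoef, ← integral_const_mul]
  simp only [Pi.smul_apply, smul_eq_mul, Complex.ofReal_mul, mul_assoc]

lemma fourierCoef_zero (h : Fin d → ℤ) : fourierCoef (0 : (Fin d → ℝ) → ℝ) h = 0 := by
  simp [fourierCoef]

variable {ρ : (Fin d → ℤ) → ℝ}

lemma MemRKHS.summable_norm (hρ : ∀ h, 0 ≤ ρ h) (hs : Summable ρ) {f : (Fin d → ℝ) → ℝ}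
    (hf : MemRKHS ρ f) : Summable fun h => ‖fourierCoef f h‖ := by
  refine (summable_and_tsum_sq_le (fun h => norm_nonneg _)
    (fun h => div_nonneg (sq_nonneg _) (hρ h)) hρ (fun h => ?_) hf.summable hs).1
  -- Since `x / 0 = 0`, the quotient says nothing where `ρ` vanishes; there the coefficient is zero
  -- by membership.
  by_cases h0 : ρ h = 0
  · simp [hf.coef_eq_zero h h0]
  · rw [div_mul_cancel₀ _ h0]

lemma MemRKHS.summable_inner (hρ : ∀ h, 0 ≤ ρ h) {f g : (Fin d → ℝ) → ℝ}
    (hf : MemRKHS ρ f) (hg : MemRKHS ρ g) :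
    Summable fun h => (fourierCoef f h * (starRingEnd ℂ) (fourierCoef g h)).re / ρ h := by
  refine Summable.of_norm ?_
  refine (summable_and_tsum_sq_le (fun h => norm_nonneg _)
    (fun h => div_nonneg (sq_nonneg _) (hρ h)) (fun h => div_nonneg (sq_nonneg _) (hρ h))
    (fun h => ?_) hf.summable hg.summable).1
  rw [norm_div, Real.norm_eq_abs, Real.norm_eq_abs, div_pow, sq_abs (ρ h), div_mul_div_comm,
    ← sq (ρ h), ← mul_pow]
  gcongr
  refine (Complex.abs_re_le_norm _).trans ?_
  rw [norm_mul, RCLike.norm_conj]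

lemma memRKHS_zero : MemRKHS ρ (0 : (Fin d → ℝ) → ℝ) where
  continuous := continuous_const
  periodic _ _ := rfl
  coef_eq_zero h _ := fourierCoef_zero h
  summable := by simp [fourierCoef_zero, summable_zero]

lemma MemRKHS.add (hρ : ∀ h, 0 ≤ ρ h) {f g : (Fin d → ℝ) → ℝ} (hf : MemRKHS ρ f)
    (hg : MemRKHS ρ g) : MemRKHS ρ (f + g) where
  continuous := hf.continuous.add hg.continuous
  periodic n x := by simp only [Pi.add_apply, hf.periodic, hg.periodic]
  coef_eq_zero h h0 := by
    rw [fourierCoef_add hf.continuous hg.continuous, hf.coef_eq_zero h h0, hg.coef_eq_zero h h0,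
      add_zero]
  summable := by
    refine Summable.of_nonneg_of_le (fun h => div_nonneg (sq_nonneg _) (hρ h)) (fun h => ?_)
      ((hf.summable.mul_left 2).add (hg.summable.mul_left 2))
    rw [fourierCoef_add hf.continuous hg.continuous, ← mul_div_assoc, ← mul_div_assoc, ← add_div]
    refine div_le_div_of_nonneg_right ?_ (hρ h)
    calc ‖fourierCoef f h + fourierCoef g h‖ ^ 2
        ≤ (‖fourierCoef f h‖ + ‖fourierCoef g h‖) ^ 2 := by gcongr; exact norm_add_le _ _
      _ ≤ _ := by nlinarith [sq_nonneg (‖fourierCoef f h‖ - ‖fourierCoef g h‖)]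

lemma MemRKHS.smul (c : ℝ) {f : (Fin d → ℝ) → ℝ} (hf : MemRKHS ρ f) : MemRKHS ρ (c • f) where
  continuous := hf.continuous.const_smul c
  periodic n x := by simp only [Pi.smul_apply, hf.periodic]
  coef_eq_zero h h0 := by rw [fourierCoef_smul, hf.coef_eq_zero h h0, mul_zero]
  summable := by
    refine (hf.summable.mul_left (c ^ 2)).congr fun h => ?_
    rw [fourierCoef_smul, norm_mul, Complex.norm_real, mul_pow, Real.norm_eq_abs, sq_abs,
      mul_div_assoc]

/-- The functions with `MemRKHS ρ` as a vector space. -/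
def rkhs (ρ : (Fin d → ℤ) → ℝ) (hρ : ∀ h, 0 ≤ ρ h) : Submodule ℝ ((Fin d → ℝ) → ℝ) where
  carrier := {f | MemRKHS ρ f}
  zero_mem' := memRKHS_zero
  add_mem' hf hg := MemRKHS.add hρ hf hg
  smul_mem' c _ hf := MemRKHS.smul c hf

lemma isPosForm_l2Inner (hρ : ∀ h, 0 ≤ ρ h) : IsPosForm (rkhs ρ hρ) l2Inner where
  symm u _ v _ := by simp only [l2Inner, mul_comm]
  add_left u hu v hv w hw := by
    have hu := hu.continuous
    have hv := hv.continuous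
    have hw := hw.continuous
    rw [l2Inner, l2Inner, l2Inner, ← integral_add]
    · simp only [Pi.add_apply, add_mul]
    · exact integrableOn_cube (by fun_prop)
    · exact integrableOn_cube (by fun_prop)
  smul_left c u _ v _ := by
    rw [l2Inner, l2Inner, ← integral_const_mul]
    simp only [Pi.smul_apply, smul_eq_mul, mul_assoc]
  nonneg u _ := integral_nonneg fun x => mul_self_nonneg _

lemma rkhsInner_self (f : (Fin d → ℝ) → ℝ) :
    rkhsInner ρ f f = ∑' h, ‖fourierCoef f h‖ ^ 2 / ρ h := by
  refine tsum_congr fun h => ?_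
  rw [Complex.mul_conj, Complex.ofReal_re, Complex.normSq_eq_norm_sq]

lemma rkhsNorm_sq (hρ : ∀ h, 0 ≤ ρ h) (f : (Fin d → ℝ) → ℝ) :
    rkhsNorm ρ f ^ 2 = rkhsInner ρ f f := by
  rw [rkhsNorm, rkhsInner_self,
    Real.sq_sqrt (tsum_nonneg fun h => div_nonneg (sq_nonneg _) (hρ h))]

lemma isPosForm_rkhsInner (hρ : ∀ h, 0 ≤ ρ h) : IsPosForm (rkhs ρ hρ) (rkhsInner ρ) where
  symm u _ v _ := by
    refine tsum_congr fun h => ?_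
    congr 1
    simp only [Complex.mul_re, Complex.conj_re, Complex.conj_im]
    ring
  add_left u hu v hv w hw := by
    rw [rkhsInner, rkhsInner, rkhsInner,
      ← (hu.summable_inner hρ hw).tsum_add (hv.summable_inner hρ hw)]
    refine tsum_congr fun h => ?_
    rw [fourierCoef_add hu.continuous hv.continuous, add_mul, Complex.add_re, add_div]
  smul_left c u _ v _ := by
    rw [rkhsInner, rkhsInner, ← tsum_mul_left]
    refine tsum_congr fun h => ?_
    rw [fourierCoef_smul, mul_assoc, Complex.re_ofReal_mul, mul_div_assoc]
  nonneg u _ := by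
    rw [rkhsInner_self]
    exact tsum_nonneg fun h => div_nonneg (sq_nonneg _) (hρ h)

lemma MemRKHS.hasSum (hρ : ∀ h, 0 ≤ ρ h) (hs : Summable ρ) {f : (Fin d → ℝ) → ℝ}
    (hf : MemRKHS ρ f) (x : Fin d → ℝ) : HasSum (fun h => fourierCoef f h * trig h x) (f x : ℂ) :=
  hasSum_fourier hf.continuous hf.periodic (hf.summable_norm hρ hs) x

lemma MemRKHS.abs_le (hρ : ∀ h, 0 ≤ ρ h) (hs : Summable ρ) {f : (Fin d → ℝ) → ℝ}
    (hf : MemRKHS ρ f) (x : Fin d → ℝ) : |f x| ≤ ∑' h, ‖fourierCoef f h‖ := by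
  have h1 := (hf.hasSum hρ hs x).tsum_eq
  have h2 : ‖(f x : ℂ)‖ ≤ ∑' h, ‖fourierCoef f h * trig h x‖ := by
    rw [← h1]
    refine norm_tsum_le_tsum_norm ?_
    simpa only [norm_mul, norm_trig, mul_one] using hf.summable_norm hρ hs
  simpa only [norm_mul, norm_trig, mul_one, Complex.norm_real, Real.norm_eq_abs] using h2

lemma MemRKHS.eq_zero (hρ : ∀ h, 0 ≤ ρ h) (hs : Summable ρ) {f : (Fin d → ℝ) → ℝ}
    (hf : MemRKHS ρ f) (h0 : rkhsInner ρ f f = 0) : f = 0 := by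
  rw [rkhsInner_self] at h0
  have h1 : ∀ h, fourierCoef f h = 0 := by
    intro h
    by_cases hh : ρ h = 0
    · exact hf.coef_eq_zero h hh
    · have h2 := (hasSum_zero_iff_of_nonneg fun h => div_nonneg (sq_nonneg _) (hρ h)).1
        (h0 ▸ hf.summable.hasSum)
      have h3 := congrFun h2 h
      simpa [hh] using h3
  ext x
  have h2 := hf.abs_le hρ hs x
  simp only [h1, norm_zero, tsum_zero] at h2
  exact abs_nonpos_iff.1 h2

/-- The regularized point evaluation bound. -/
lemma MemRKHS.sq_le (hρ : ∀ h, 0 ≤ ρ h) (hs : Summable ρ) {lam : ℝ} (hlam : 0 < lam)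
    {f : (Fin d → ℝ) → ℝ} (hf : MemRKHS ρ f) (x : Fin d → ℝ) :
    f x ^ 2 ≤ (∑' h, ρ h / (ρ h + lam)) * (l2Inner f f + lam * rkhsInner ρ f f) := by
  have hp := hasSum_sq_fourierCoef hf.continuous hf.periodic
  have hw : Summable fun h => ρ h / (ρ h + lam) := by
    refine Summable.of_nonneg_of_le (fun h => div_nonneg (hρ h) (by linarith [hρ h]))
      (fun h => ?_) (hs.div_const lam)
    exact div_le_div_of_nonneg_left (hρ h) hlam (by linarith [hρ h])
  have hA : HasSum (fun h => ‖fourierCoef f h‖ ^ 2 + lam * (‖fourierCoef f h‖ ^ 2 / ρ h))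
      (l2Inner f f + lam * rkhsInner ρ f f) := by
    rw [rkhsInner_self]
    exact hp.add (hf.summable.hasSum.mul_left lam)
  -- Cauchy-Schwarz with `|f̂|² = |f̂|²(1 + λ/ρ) · ρ/(ρ+λ)`: the first factors sum to the
  -- regularized norm, the second to the effective dimension.
  have key := (summable_and_tsum_sq_le (c := fun h => ‖fourierCoef f h‖) (fun h => norm_nonneg _)
    (fun h => add_nonneg (sq_nonneg _) (mul_nonneg hlam.le (div_nonneg (sq_nonneg _) (hρ h))))
    (fun h => div_nonneg (hρ h) (by linarith [hρ h])) (fun h => ?_) hA.summable hw).2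
  · rw [hA.tsum_eq, mul_comm] at key
    refine le_trans ?_ key
    rw [← sq_abs]
    exact pow_le_pow_left₀ (abs_nonneg _) (hf.abs_le hρ hs x) 2
  · by_cases h0 : ρ h = 0
    · simp [hf.coef_eq_zero h h0]
    · have h1 : 0 < ρ h := lt_of_le_of_ne (hρ h) (Ne.symm h0)
      refine le_of_eq ?_
      field_simp

section Kernel

variable (hρ : ∀ h, 0 ≤ ρ h) (hs : Summable ρ) (he : ∀ h, ρ (-h) = ρ h)
include hρ hs he

omit hρ hs in
lemma kernel_eq_tsum (x y : Fin d → ℝ) :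
    (kernel ρ x y : ℂ) = ∑' h, (ρ h * trig (-h) x) * trig h y := by
  have h1 : (kernel ρ x y : ℂ) = ∑' h : Fin d → ℤ, (ρ h : ℂ) * trig h (x - y) := by
    rw [kernel]
    -- Evenness of `ρ` makes the series its own conjugate, so taking the real part loses nothing.
    refine Complex.conj_eq_iff_re.1 ?_
    rw [Complex.conj_tsum, ← (Equiv.neg (Fin d → ℤ)).tsum_eq]
    refine tsum_congr fun h => ?_
    rw [Equiv.neg_apply, he, map_mul, Complex.conj_ofReal, trig_neg_left, Complex.conj_conj]
  rw [h1, ← (Equiv.neg (Fin d → ℤ)).tsum_eq]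
  refine tsum_congr fun h => ?_
  rw [Equiv.neg_apply, he, trig_sub_right, neg_neg, mul_assoc]

omit he in
lemma summable_norm_kernel_coef (x : Fin d → ℝ) :
    Summable fun h => ‖(ρ h * trig (-h) x : ℂ)‖ := by
  refine hs.congr fun h => ?_
  rw [norm_mul, norm_trig, mul_one, Complex.norm_real, Real.norm_of_nonneg (hρ h)]

lemma fourierCoef_kernel (x : Fin d → ℝ) (h : Fin d → ℤ) :
    fourierCoef (kernel ρ x) h = ρ h * trig (-h) x :=
  fourierCoef_of_hasSum (summable_norm_kernel_coef hρ hs x) (kernel_eq_tsum he x) h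

lemma memRKHS_kernel (x : Fin d → ℝ) : MemRKHS ρ (kernel ρ x) where
  continuous := continuous_of_hasSum (summable_norm_kernel_coef hρ hs x)
    (kernel_eq_tsum he x)
  periodic n y := by
    have h1 := kernel_eq_tsum he x
    apply Complex.ofReal_injective
    rw [h1, h1]
    simp only [trig_add_int]
  coef_eq_zero h h0 := by rw [fourierCoef_kernel hρ hs he, h0, Complex.ofReal_zero, zero_mul]
  summable := by
    refine hs.congr fun h => ?_
    rw [fourierCoef_kernel hρ hs he, norm_mul, norm_trig, mul_one, Complex.norm_real,
      Real.norm_of_nonneg (hρ h)]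
    by_cases h0 : ρ h = 0
    · simp [h0]
    · field_simp

/-- The reproducing property. -/
lemma rkhsInner_kernel {f : (Fin d → ℝ) → ℝ} (hf : MemRKHS ρ f) (x : Fin d → ℝ) :
    rkhsInner ρ f (kernel ρ x) = f x := by
  have h1 := Complex.hasSum_re (hf.hasSum hρ hs x)
  rw [Complex.ofReal_re] at h1
  rw [← h1.tsum_eq]
  refine tsum_congr fun h => ?_
  rw [fourierCoef_kernel hρ hs he, map_mul, Complex.conj_ofReal, trig_neg_left, Complex.conj_conj]
  by_cases h0 : ρ h = 0
  · simp [h0, hf.coef_eq_zero h h0]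
  · rw [mul_left_comm, Complex.re_ofReal_mul, mul_div_cancel_left₀ _ h0]

lemma approxSpace_le (N : ℕ) (z : Fin d → ℕ) : approxSpace ρ N z ≤ rkhs ρ hρ := by
  refine Submodule.span_le.2 ?_
  rintro _ ⟨k, rfl⟩
  exact memRKHS_kernel hρ hs he _

end Kernel

instance finiteDimensional_approxSpace (ρ : (Fin d → ℤ) → ℝ) (N : ℕ) (z : Fin d → ℕ) :
    FiniteDimensional ℝ (approxSpace ρ N z) :=
  FiniteDimensional.span_of_finite ℝ (Set.finite_range _)

end RKHS

/-! ### Rank-1 lattices: characters, aliasing, quality measure. -/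

section Lattice

variable {d : ℕ}

lemma trig_latticePoint (N : ℕ) (z : Fin d → ℕ) (k : Fin N) (h : Fin d → ℤ) :
    trig h (latticePoint N z k)
      = Complex.exp (2 * Real.pi * Complex.I * ((∑ j, h j * (z j : ℤ) : ℤ) / (N : ℂ)))
        ^ ((k : ℕ) + 1) := by
  have h1 : trig h (latticePoint N z k)
      = trig h (fun j => (((k : ℕ) + 1 : ℕ) : ℝ) * (z j : ℝ) / (N : ℝ)) := by
    rw [← trig_add_int h (fun j => ⌊(((k : ℕ) + 1 : ℕ) : ℝ) * (z j : ℝ) / (N : ℝ)⌋)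
      (latticePoint N z k)]
    congr 1
    ext j
    exact Int.fract_add_floor _
  rw [h1, trig, ← Complex.exp_nat_mul]
  congr 1
  push_cast
  simp only [Finset.mul_sum, Finset.sum_div]
  refine Finset.sum_congr rfl fun j _ => ?_
  ring

/-- The values are the powers `w, …, w^N` of an `N`-th root of unity `w`, and `w = 1` exactly when
`h` lies in the dual lattice. -/
lemma sum_trig_latticePoint {N : ℕ} (hN : N ≠ 0) (z : Fin d → ℕ) (h : Fin d → ℤ) :
    ∑ k : Fin N, trig h (latticePoint N z k)
      = if (N : ℤ) ∣ ∑ j, h j * (z j : ℤ) then (N : ℂ) else 0 := by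
  simp only [trig_latticePoint]
  set a : ℤ := ∑ j, h j * (z j : ℤ) with ha
  set w : ℂ := Complex.exp (2 * Real.pi * Complex.I * ((a : ℂ) / (N : ℂ))) with hw
  have hN' : (N : ℂ) ≠ 0 := Nat.cast_ne_zero.2 hN
  have hpi : (2 * Real.pi * Complex.I : ℂ) ≠ 0 := Complex.two_pi_I_ne_zero
  have hw1 : w = 1 ↔ (N : ℤ) ∣ a := by
    rw [hw, Complex.exp_eq_one_iff]
    constructor
    · rintro ⟨n, hn⟩
      refine ⟨n, ?_⟩
      rw [mul_comm (n : ℂ)] at hn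
      have h1 := mul_left_cancel₀ hpi hn
      rw [div_eq_iff hN'] at h1
      rw [mul_comm]
      exact_mod_cast h1
    · rintro ⟨n, hn⟩
      refine ⟨n, ?_⟩
      rw [hn]
      push_cast
      field_simp
  have hwN : w ^ N = 1 := by
    rw [hw, ← Complex.exp_nat_mul, Complex.exp_eq_one_iff]
    refine ⟨a, ?_⟩
    field_simp
  rw [Fin.sum_univ_eq_sum_range (fun k => w ^ (k + 1)) N]
  split_ifs with h
  · rw [hw1.2 h]
    simp
  · have h1 : w ≠ 1 := fun h2 => h (hw1.1 h2)
    simp only [pow_succ, ← Finset.sum_mul]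
    rw [geom_sum_eq h1, hwN]
    simp

variable {ρ : (Fin d → ℤ) → ℝ}

open Classical in
/-- The lattice quality measure `S_d(z)`. -/
def latticeQuality (ρ : (Fin d → ℤ) → ℝ) (N : ℕ) (z : Fin d → ℕ) : ℝ :=
  ∑' p : (Fin d → ℤ) × (Fin d → ℤ),
    if p.2 ≠ 0 ∧ (N : ℤ) ∣ ∑ j, p.2 j * (z j : ℤ) then ρ p.1 * ρ (p.1 + p.2) else 0

lemma summable_mul_shift (hρ : ∀ h, 0 ≤ ρ h) (hs : Summable ρ) :
    Summable fun p : (Fin d → ℤ) × (Fin d → ℤ) => ρ p.1 * ρ (p.1 + p.2) := by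
  have hinj : Function.Injective
      fun p : (Fin d → ℤ) × (Fin d → ℤ) => (p.1, p.1 + p.2) := by
    rintro ⟨a, b⟩ ⟨a', b'⟩ h
    simp only [Prod.mk.injEq] at h
    obtain ⟨rfl, h⟩ := h
    rw [add_left_cancel h]
  exact (hs.mul_of_nonneg hs hρ hρ).comp_injective hinj

lemma summable_mul_shift_ite (hρ : ∀ h, 0 ≤ ρ h) (hs : Summable ρ)
    (Q : (Fin d → ℤ) × (Fin d → ℤ) → Prop) [DecidablePred Q] :
    Summable fun p => if Q p then ρ p.1 * ρ (p.1 + p.2) else 0 := by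
  refine Summable.of_nonneg_of_le (fun p => ?_) (fun p => ?_) (summable_mul_shift hρ hs)
  · split_ifs
    · exact mul_nonneg (hρ _) (hρ _)
    · exact le_rfl
  · split_ifs
    · exact le_rfl
    · exact mul_nonneg (hρ _) (hρ _)

open Classical in
/-- Aliasing for functions that vanish at the lattice points. -/
lemma aliasing (hρ : ∀ h, 0 ≤ ρ h) (hs : Summable ρ) {N : ℕ} (hN : N ≠ 0) {z : Fin d → ℕ}
    {q : (Fin d → ℝ) → ℝ} (hq : MemRKHS ρ q) (h0 : ∀ k, q (latticePoint N z k) = 0)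
    (h : Fin d → ℤ) :
    HasSum (fun l : Fin d → ℤ =>
      if (N : ℤ) ∣ ∑ j, l j * (z j : ℤ) then fourierCoef q (h + l) else 0) 0 := by
  have h1 : ∀ k : Fin N, HasSum (fun l => fourierCoef q (h + l) * trig l (latticePoint N z k)) 0 := by
    intro k
    have h2 := hq.hasSum hρ hs (latticePoint N z k)
    rw [h0 k, Complex.ofReal_zero, ← (Equiv.addLeft h).hasSum_iff] at h2
    -- Multiplying by the character `-h` turns the Fourier series at `x_k` into one in `l`; summing
    -- over `k` then keeps only the dual lattice.
    have h3 := h2.mul_left (trig (-h) (latticePoint N z k))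
    rw [mul_zero] at h3
    refine h3.congr_fun fun l => ?_
    simp only [Function.comp_apply, Equiv.coe_addLeft]
    rw [mul_left_comm, ← trig_add_left, neg_add_cancel_left]
  have h4 := hasSum_sum (s := Finset.univ) fun k _ => h1 k
  simp only [← Finset.mul_sum, sum_trig_latticePoint hN, Finset.sum_const_zero] at h4
  have h5 := h4.mul_right (N : ℂ)⁻¹
  rw [zero_mul] at h5
  have hN' : (N : ℂ) ≠ 0 := Nat.cast_ne_zero.2 hN
  refine h5.congr_fun fun l => ?_
  split_ifs
  · field_simp
  · simp

/-- The `L²` norm of a function that vanishes at the lattice points. -/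
lemma l2Inner_le_of_vanish (hρ : ∀ h, 0 ≤ ρ h) (hs : Summable ρ) {N : ℕ} (hN : N ≠ 0)
    {z : Fin d → ℕ} {q : (Fin d → ℝ) → ℝ} (hq : MemRKHS ρ q)
    (h0 : ∀ k, q (latticePoint N z k) = 0) {m : ℝ} (hm : 0 < m) :
    l2Inner q q ≤ (1 / m + m * latticeQuality ρ N z) * rkhsInner ρ q q := by
  classical
  set Q := rkhsInner ρ q q with hQ
  have hQ0 : 0 ≤ Q := (isPosForm_rkhsInner hρ).nonneg q hq
  have hQs : HasSum (fun h => ‖fourierCoef q h‖ ^ 2 / ρ h) Q := by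
    rw [hQ, rkhsInner_self]
    exact hq.summable.hasSum
  let R : (Fin d → ℤ) → ℝ := fun h => ∑' l : Fin d → ℤ,
    if l ≠ 0 ∧ (N : ℤ) ∣ ∑ j, l j * (z j : ℤ) then ρ (h + l) else 0
  have hRs : ∀ h, Summable fun l : Fin d → ℤ =>
      if l ≠ 0 ∧ (N : ℤ) ∣ ∑ j, l j * (z j : ℤ) then ρ (h + l) else 0 := by
    intro h
    refine Summable.of_nonneg_of_le (fun l => ?_) (fun l => ?_)
      ((Equiv.addLeft h).summable_iff.2 hs)
    · split_ifs
      exacts [hρ _, le_rfl]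
    · split_ifs
      exacts [le_rfl, hρ _]
  have hR0 : ∀ h, 0 ≤ R h := fun h => tsum_nonneg fun l => by
    split_ifs
    exacts [hρ _, le_rfl]
  have hT := summable_mul_shift_ite hρ hs
    fun p => p.2 ≠ 0 ∧ (N : ℤ) ∣ ∑ j, p.2 j * (z j : ℤ)
  have hS : HasSum (fun h => ρ h * R h) (latticeQuality ρ N z) := by
    have h1 := hT.hasSum.prod_fiberwise fun h => (hT.prod_factor h).hasSum
    refine h1.congr_fun fun h => ?_
    simp only [R, ← tsum_mul_left, mul_ite, mul_zero]
  have hbound : ∀ h, ‖fourierCoef q h‖ ^ 2 ≤ Q * R h := by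
    intro h
    have h1 := aliasing hρ hs hN hq h0 h
    -- Removing the term `l = 0`, which is `q̂(h)`, leaves a series with sum `-q̂(h)`.
    have h2 := h1.update 0 0
    simp only [zero_sub, Pi.zero_apply, dvd_zero, zero_mul, Finset.sum_const_zero, if_true,
      add_zero] at h2
    have h3 : ‖fourierCoef q h‖ = ‖∑' l : Fin d → ℤ, Function.update (fun l : Fin d → ℤ =>
      if (N : ℤ) ∣ ∑ j, l j * (z j : ℤ) then fourierCoef q (h + l) else 0) 0 0 l‖ := by
      rw [h2.tsum_eq, norm_neg]
    have hc : ∀ l : Fin d → ℤ, ‖Function.update (fun l : Fin d → ℤ =>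
      if (N : ℤ) ∣ ∑ j, l j * (z j : ℤ) then fourierCoef q (h + l) else 0) 0 0 l‖ ^ 2
        ≤ (‖fourierCoef q (h + l)‖ ^ 2 / ρ (h + l)) *
          if l ≠ 0 ∧ (N : ℤ) ∣ ∑ j, l j * (z j : ℤ) then ρ (h + l) else 0 := by
      intro l
      by_cases hl : l = 0
      · simp [hl]
      · rw [Function.update_of_ne hl]
        by_cases hd : (N : ℤ) ∣ ∑ j, l j * (z j : ℤ)
        · rw [if_pos hd, if_pos ⟨hl, hd⟩]
          by_cases hr : ρ (h + l) = 0
          · simp [hq.coef_eq_zero _ hr]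
          · rw [div_mul_cancel₀ _ hr]
        · simp [hd]
    have hQ' := (Equiv.addLeft h).hasSum_iff.2 hQs
    have h4 := summable_and_tsum_sq_le (fun l => norm_nonneg _)
      (fun l => div_nonneg (sq_nonneg _) (hρ (h + l)))
      (fun l => by split_ifs; exacts [hρ _, le_rfl]) hc hQ'.summable (hRs h)
    have h5 : ∑' l, ‖fourierCoef q (h + l)‖ ^ 2 / ρ (h + l) = Q := hQ'.tsum_eq
    rw [h5] at h4
    rw [h3]
    refine le_trans ?_ h4.2
    exact pow_le_pow_left₀ (norm_nonneg _) (norm_tsum_le_tsum_norm h4.1) 2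
  have hmain : ∀ h, ‖fourierCoef q h‖ ^ 2
      ≤ 1 / m * (‖fourierCoef q h‖ ^ 2 / ρ h) + m * Q * (ρ h * R h) := by
    intro h
    have hnn : 0 ≤ m * Q * (ρ h * R h) :=
      mul_nonneg (mul_nonneg hm.le hQ0) (mul_nonneg (hρ h) (hR0 h))
    rcases eq_or_ne (ρ h) 0 with hr | hr
    · simp [hr, hq.coef_eq_zero _ hr]
    have hr' : 0 < ρ h := lt_of_le_of_ne (hρ h) hr.symm
    -- For `ρ(h) ≤ 1/m` the norm of `q` controls the coefficient directly; for `ρ(h) ≥ 1/m` the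
    -- aliasing bound is used, multiplied by `m ρ(h) ≥ 1`.
    rcases le_total (m * ρ h) 1 with h1 | h1
    · refine le_trans ?_ (le_add_of_nonneg_right hnn)
      rw [div_mul_div_comm, one_mul, le_div_iff₀ (mul_pos hm hr')]
      exact mul_le_of_le_one_right (sq_nonneg _) h1
    · refine le_trans ?_ (le_add_of_nonneg_left
        (mul_nonneg (one_div_pos.2 hm).le (div_nonneg (sq_nonneg _) (hρ h))))
      calc ‖fourierCoef q h‖ ^ 2 ≤ Q * R h := hbound h
        _ ≤ (m * ρ h) * (Q * R h) := le_mul_of_one_le_left (mul_nonneg hQ0 (hR0 h)) h1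
        _ = _ := by ring
  have h6 := hasSum_le hmain (hasSum_sq_fourierCoef hq.continuous hq.periodic)
    ((hQs.mul_left (1 / m)).add (hS.mul_left (m * Q)))
  linarith

lemma mem_supp {h : Fin d → ℤ} {j : Fin d} : j ∈ supp h ↔ h j ≠ 0 := by simp [supp]

lemma exists_last_ne_zero {l : Fin d → ℤ} (h0 : l ≠ 0) : ∃ t, l t ≠ 0 ∧ ∀ j, t < j → l j = 0 := by
  have hne : (supp l).Nonempty := by
    obtain ⟨j, hj⟩ := Function.ne_iff.1 h0
    exact ⟨j, mem_supp.2 hj⟩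
  refine ⟨(supp l).max' hne, mem_supp.1 ((supp l).max'_mem hne), fun j hj => ?_⟩
  by_contra hj0
  exact absurd ((supp l).le_max' j (mem_supp.2 hj0)) (not_le.2 hj)

open Classical in
/-- The quality measure is the sum of the component-by-component criteria. -/
lemma latticeQuality_eq_sum (hρ : ∀ h, 0 ≤ ρ h) (hs : Summable ρ) (N : ℕ) (z : Fin d → ℕ) :
    latticeQuality ρ N z = ∑ s, cbcCriterion ρ N s z := by
  unfold latticeQuality cbcCriterion
  rw [← Summable.tsum_finsetSum fun s _ => summable_mul_shift_ite hρ hs _]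
  refine tsum_congr fun p => ?_
  by_cases h0 : p.2 = 0
  · simp [h0]
  obtain ⟨t, ht1, ht2⟩ := exists_last_ne_zero h0
  have h1 : ∀ s, (p.2 s ≠ 0 ∧ (∀ j, s < j → p.2 j = 0) ∧ (N : ℤ) ∣ ∑ j, p.2 j * (z j : ℤ))
      ↔ s = t ∧ (N : ℤ) ∣ ∑ j, p.2 j * (z j : ℤ) := by
    intro s
    constructor
    · rintro ⟨h1, h2, h3⟩
      refine ⟨?_, h3⟩
      rcases lt_trichotomy s t with h | h | h
      · exact absurd (h2 t h) ht1
      · exact h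
      · exact absurd (ht2 s h) h1
    · rintro ⟨rfl, h3⟩
      exact ⟨ht1, ht2, h3⟩
  simp only [h1, h0, ne_eq, not_false_eq_true, true_and, ite_and]
  rw [Finset.sum_ite_eq', if_pos (Finset.mem_univ _)]

lemma cbcCriterion_nonneg (hρ : ∀ h, 0 ≤ ρ h) (N : ℕ) (s : Fin d) (z : Fin d → ℕ) :
    0 ≤ cbcCriterion ρ N s z := by
  refine tsum_nonneg fun p => ?_
  split_ifs
  · exact mul_nonneg (hρ _) (hρ _)
  · exact le_rfl

end Lattice

/-! ### Interpolation error and bias of the regularized projection. -/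

section Bias

variable {d : ℕ} {ρ : (Fin d → ℤ) → ℝ} (hρ : ∀ h, 0 ≤ ρ h) (hs : Summable ρ)
  (he : ∀ h, ρ (-h) = ρ h)
include hρ hs he

/-- The kernel interpolant of `f` at the lattice points. -/
lemma exists_interpolant {N : ℕ} (hN : N ≠ 0) (z : Fin d → ℕ) {f : (Fin d → ℝ) → ℝ}
    (hf : MemRKHS ρ f) :
    ∃ p ∈ approxSpace ρ N z, (∀ v ∈ approxSpace ρ N z, rkhsInner ρ p v = rkhsInner ρ f v) ∧
      ∀ m : ℝ, 0 < m → l2Inner (f - p) (f - p)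
        ≤ (1 / m + m * latticeQuality ρ N z) * rkhsInner ρ f f := by
  have hVE := approxSpace_le hρ hs he N z
  have hK := isPosForm_rkhsInner hρ
  obtain ⟨n, φ, hφ, hon, hexp⟩ := (hK.mono hVE).exists_orthonormal
    fun v hv => MemRKHS.eq_zero hρ hs (hVE hv)
  -- The `K`-orthogonal projection of `f` onto `V_N`. It interpolates, since pairing with `K(x_k,
  -- ·)` is evaluation at `x_k`.
  set p := ∑ i, rkhsInner ρ f (φ i) • φ i with hp
  have hpV : p ∈ approxSpace ρ N z := Submodule.sum_mem _ fun i _ => Submodule.smul_mem _ _ (hφ i)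
  have hfE : f ∈ rkhs ρ hρ := hf
  have horth : ∀ v ∈ approxSpace ρ N z, rkhsInner ρ p v = rkhsInner ρ f v := by
    intro v hv
    rw [hp, hK.sum_smul_left _ _ _ (fun i => hVE (hφ i)) (hVE hv)]
    conv_rhs => rw [hexp v hv]
    rw [hK.symm _ hfE _ (Submodule.sum_mem _ fun i _ => Submodule.smul_mem _ _ (hVE (hφ i))),
      hK.sum_smul_left _ _ _ (fun i => hVE (hφ i)) hfE]
    refine Finset.sum_congr rfl fun i _ => ?_
    rw [hK.symm _ (hVE (hφ i)) _ (hVE hv), hK.symm _ (hVE (hφ i)) _ hfE, mul_comm]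
  refine ⟨p, hpV, horth, fun m hm => ?_⟩
  have hq : f - p ∈ rkhs ρ hρ := Submodule.sub_mem _ hfE (hVE hpV)
  have h0 : ∀ k, (f - p) (latticePoint N z k) = 0 := by
    intro k
    have hk : kernel ρ (latticePoint N z k) ∈ approxSpace ρ N z := Submodule.subset_span ⟨k, rfl⟩
    rw [← rkhsInner_kernel hρ hs he hq, hK.sub_left hfE (hVE hpV) (hVE hk), horth _ hk, sub_self]
  refine (l2Inner_le_of_vanish hρ hs hN hq h0 hm).trans ?_
  have hS : 0 ≤ latticeQuality ρ N z := by
    rw [latticeQuality_eq_sum hρ hs]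
    exact Finset.sum_nonneg fun s _ => cbcCriterion_nonneg hρ N s z
  refine mul_le_mul_of_nonneg_left ?_ (by positivity)
  -- Pythagoras: the residual has no larger `K`-norm than `f`.
  have h1 : rkhsInner ρ (f - p) (f - p) = rkhsInner ρ f f - rkhsInner ρ p p := by
    rw [hK.sub_left hfE (hVE hpV) hq, hK.sub_right hfE (hVE hpV) hfE,
      hK.sub_right hfE (hVE hpV) (hVE hpV), hK.symm _ hfE _ (hVE hpV), horth p hpV,
      hK.symm _ hfE _ (hVE hpV)]
    ring
  have h2 := hK.nonneg p (hVE hpV)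
  linarith

omit hs he in
lemma neg_mul_rkhsInner_le {f w : (Fin d → ℝ) → ℝ} (hf : MemRKHS ρ f) (hw : MemRKHS ρ w)
    (hf2 : MemRKHS (fun h => ρ h ^ 2) f) (lam : ℝ) :
    -(lam * rkhsInner ρ f w)
      ≤ 1 / 4 * l2Inner w w + lam ^ 2 * rkhsInner (fun h => ρ h ^ 2) f f := by
  rw [rkhsInner_self, ← mul_neg]
  have h1 := (hf.summable_inner hρ hw).hasSum.neg.mul_left lam
  have h2 := ((hasSum_sq_fourierCoef hw.continuous hw.periodic).mul_left (1 / 4)).add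
    (hf2.summable.hasSum.mul_left (lam ^ 2))
  refine hasSum_le (fun h => ?_) h1 h2
  set a := fourierCoef f h
  set b := fourierCoef w h
  have h3 : |(a * (starRingEnd ℂ) b).re| ≤ ‖a‖ * ‖b‖ := by
    refine (Complex.abs_re_le_norm _).trans ?_
    rw [norm_mul, RCLike.norm_conj]
  have h4 : lam * -((a * (starRingEnd ℂ) b).re / ρ h) ≤ |lam| * (‖a‖ / ρ h) * ‖b‖ := by
    refine (le_abs_self _).trans ?_
    rw [abs_mul, abs_neg, abs_div, abs_of_nonneg (hρ h), mul_assoc, div_mul_eq_mul_div]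
    exact mul_le_mul_of_nonneg_left (div_le_div_of_nonneg_right h3 (hρ h)) (abs_nonneg _)
  refine h4.trans ?_
  rw [← div_pow, ← sq_abs lam, ← mul_pow]
  -- Termwise `xy ≤ x² + y²/4` with `x = |λ||f̂|/ρ`: the smoother norm absorbs `ρ⁻²`, leaving only
  -- an `L²` term in `w`.
  nlinarith [sq_nonneg (|lam| * (‖a‖ / ρ h) - 1 / 2 * ‖b‖)]

/-- The approximation error of the regularized projection of `f` on `V_N`. -/
lemma l2Inner_bias_le {N : ℕ} (hN : N ≠ 0) (z : Fin d → ℕ) {f u : (Fin d → ℝ) → ℝ}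
    (hf : MemRKHS ρ f) {lam : ℝ} (hlam : 0 < lam) (hu : u ∈ approxSpace ρ N z)
    (huA : ∀ v ∈ approxSpace ρ N z, l2Inner u v + lam * rkhsInner ρ u v = l2Inner f v)
    {b : ℝ} (hb : ∃ m : ℝ, 0 < m ∧ 1 / m + m * latticeQuality ρ N z ≤ b) :
    l2Inner (u - f) (u - f) ≤ 4 * (b * rkhsInner ρ f f) + 2 * (lam * rkhsInner ρ f f) ∧
      (MemRKHS (fun h => ρ h ^ 2) f → l2Inner (u - f) (u - f) ≤ 6 * (b * rkhsInner ρ f f)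
        + 4 * (lam ^ 2 * rkhsInner (fun h => ρ h ^ 2) f f)) := by
  obtain ⟨m, hm, hmb⟩ := hb
  have hVE := approxSpace_le hρ hs he N z
  have hK := isPosForm_rkhsInner hρ
  have hL := isPosForm_l2Inner hρ
  have hfE : f ∈ rkhs ρ hρ := hf
  obtain ⟨p, hpV, hpK, hpq⟩ := exists_interpolant hρ hs he hN z hf
  have hqb : l2Inner (f - p) (f - p) ≤ b * rkhsInner ρ f f :=
    (hpq m hm).trans (mul_le_mul_of_nonneg_right hmb (hK.nonneg f hf))
  have hwV : u - p ∈ approxSpace ρ N z := Submodule.sub_mem _ hu hpV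
  have hqE : f - p ∈ rkhs ρ hρ := Submodule.sub_mem _ hfE (hVE hpV)
  have huE := hVE hu
  have hpE := hVE hpV
  -- The equations for `u` and `p`, tested with `w = u - p`, give `A(w,w) = ⟨q,w⟩_{L²} - λ⟨f,w⟩_K`,
  -- where `q = f - p`.
  have hA : l2Inner (u - p) (u - p) + lam * rkhsInner ρ (u - p) (u - p)
      = l2Inner (f - p) (u - p) - lam * rkhsInner ρ f (u - p) := by
    have h1 := huA _ hwV
    have h2 := hpK _ hwV
    have e1 := hL.sub_left huE hpE (hVE hwV)
    have e2 := hK.sub_left huE hpE (hVE hwV)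
    have e3 := hL.sub_left hfE hpE (hVE hwV)
    rw [e1, e2, e3, h2]
    linarith
  have hsplit : l2Inner (u - f) (u - f)
      ≤ 2 * l2Inner (u - p) (u - p) + 2 * l2Inner (f - p) (f - p) := by
    have h1 := hL.add_self_le (hVE hwV) (Submodule.sub_mem _ hpE hfE)
    rw [sub_add_sub_cancel] at h1
    have h2 : l2Inner (p - f) (p - f) = l2Inner (f - p) (f - p) := by
      simp only [l2Inner, Pi.sub_apply]
      congr 1
      ext x
      ring
    linarith
  have hqw := hL.two_mul_le hqE (hVE hwV)
  constructor
  · have h1 := hK.two_mul_le ((rkhs ρ hρ).neg_mem hfE) (hVE hwV)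
    have hneg : ∀ v ∈ rkhs ρ hρ, rkhsInner ρ (-f) v = -rkhsInner ρ f v := fun v hv => by
      have := hK.smul_left (-1) f hfE v hv
      rwa [neg_one_smul, neg_one_mul] at this
    rw [hneg _ (hVE hwV), hneg _ ((rkhs ρ hρ).neg_mem hfE),
      hK.symm _ hfE _ ((rkhs ρ hρ).neg_mem hfE), hneg _ hfE] at h1
    have h2 := mul_le_mul_of_nonneg_left h1 hlam.le
    have h3 := mul_nonneg hlam.le (hK.nonneg _ (hVE hwV))
    linarith
  · intro hf2
    have h1 := neg_mul_rkhsInner_le hρ hf (hVE hwV) hf2 lam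
    have h3 := mul_nonneg hlam.le (hK.nonneg _ (hVE hwV))
    -- Doubling `q` gives `⟨q,w⟩ ≤ ‖q‖² + ‖w‖²/4`. With the quarter from `h1`, half of `‖w‖²` is
    -- absorbed.
    have h4 := hL.two_mul_le ((rkhs ρ hρ).smul_mem 2 hqE) (hVE hwV)
    rw [hL.smul_left _ _ hqE _ (hVE hwV), hL.smul_left _ _ hqE _ ((rkhs ρ hρ).smul_mem 2 hqE),
      hL.smul_right _ hqE hqE] at h4
    linarith

end Bias

/-! ### Sample means of a fixed function. -/

section Variance

variable {d : ℕ}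

lemma integral_sample {M : ℕ} {Ω : Type*} [MeasurableSpace Ω] {P : Measure Ω}
    {f : (Fin d → ℝ) → ℝ} (hf : Continuous f) (hf0 : ∀ x, 0 ≤ f x) {Y : Fin M → Ω → Fin d → ℝ}
    (hY : IsSample P f Y) {g : (Fin d → ℝ) → ℝ} (hg : Continuous g) (m : Fin M) :
    ∫ ω, g (Y m ω) ∂P = l2Inner f g := by
  rw [← integral_map (hY.measurable m).aemeasurable hg.aestronglyMeasurable, hY.law m,
    integral_withDensity_eq_integral_toReal_smul (by fun_prop) (by simp)]
  simp only [ENNReal.toReal_ofReal (hf0 _), smul_eq_mul, l2Inner]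

/-- The mean squared error of a sample mean. -/
lemma integral_sq_sampleMean_le {M : ℕ} (hM : 1 ≤ M) {Ω : Type*} [MeasurableSpace Ω]
    {P : Measure Ω} [IsProbabilityMeasure P]
    {f : (Fin d → ℝ) → ℝ} (hf : Continuous f) (hf0 : ∀ x, 0 ≤ f x) {Y : Fin M → Ω → Fin d → ℝ}
    (hY : IsSample P f Y) {g : (Fin d → ℝ) → ℝ} (hg : Continuous g) {b : ℝ} (hb : ∀ x, |g x| ≤ b) :
    Integrable (fun ω => (1 / (M : ℝ) * ∑ m, g (Y m ω) - l2Inner f g) ^ 2) P ∧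
    ∫ ω, (1 / (M : ℝ) * ∑ m, g (Y m ω) - l2Inner f g) ^ 2 ∂P
      ≤ 1 / M * l2Inner f (fun x => g x ^ 2) := by
  have hM0 : (M : ℝ) ≠ 0 := by positivity
  have hmeas : ∀ m, Measurable fun ω => g (Y m ω) := fun m => hg.measurable.comp (hY.measurable m)
  have hL : ∀ m, MemLp (fun ω => g (Y m ω)) 2 P := fun m =>
    MemLp.of_bound (hmeas m).aestronglyMeasurable b (Filter.Eventually.of_forall fun ω => hb _)
  have hind : iIndepFun (fun m ω => g (Y m ω)) P := hY.indep.comp (fun _ => g) fun _ => hg.measurable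
  have hmean : ∫ ω, (1 / (M : ℝ) * ∑ m, g (Y m ω)) ∂P = l2Inner f g := by
    rw [integral_const_mul, integral_finsetSum _ fun m _ => (hL m).integrable one_le_two]
    simp only [integral_sample hf hf0 hY hg, Finset.sum_const, Finset.card_univ, Fintype.card_fin,
      nsmul_eq_mul]
    field_simp
  have hsum : MemLp (fun ω => ∑ m, g (Y m ω)) 2 P := memLp_finsetSum _ fun m _ => hL m
  have hLM : MemLp (fun ω => 1 / (M : ℝ) * ∑ m, g (Y m ω)) 2 P := hsum.const_mul _
  refine ⟨(hLM.sub (memLp_const (l2Inner f g))).integrable_sq, ?_⟩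
  have h1 := variance_eq_integral (μ := P) hLM.aestronglyMeasurable.aemeasurable
  rw [hmean] at h1
  rw [← h1, variance_const_mul]
  -- Independence makes variances additive; each is then bounded by a second moment.
  have h2 : Var[fun ω => ∑ m, g (Y m ω); P] = ∑ m, Var[fun ω => g (Y m ω); P] := by
    have := IndepFun.variance_sum (μ := P) (X := fun m ω => g (Y m ω)) (s := Finset.univ)
      (fun m _ => hL m) (fun i _ j _ hij => hind.indepFun hij)
    rw [← this]
    congr 1
    ext ω
    simp
  have h3 : ∀ m, Var[fun ω => g (Y m ω); P] ≤ l2Inner f (fun x => g x ^ 2) := by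
    intro m
    refine (variance_le_expectation_sq (hmeas m).aestronglyMeasurable).trans (le_of_eq ?_)
    exact integral_sample hf hf0 hY (g := fun x => g x ^ 2) (hg.pow 2) m
  rw [h2]
  calc (1 / (M : ℝ)) ^ 2 * ∑ m, Var[fun ω => g (Y m ω); P]
      ≤ (1 / (M : ℝ)) ^ 2 * ∑ _m : Fin M, l2Inner f (fun x => g x ^ 2) := by
        gcongr with m
        exact h3 m
    _ = _ := by
        simp only [Finset.sum_const, Finset.card_univ, Fintype.card_fin, nsmul_eq_mul]
        field_simp

end Variance

/-! ### Bias-variance decomposition. -/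

section Mise

variable {d : ℕ} {ρ : (Fin d → ℤ) → ℝ} (hρ : ∀ h, 0 ≤ ρ h) (hs : Summable ρ)
  (he : ∀ h, ρ (-h) = ρ h)
include hρ hs he

/-- The mean integrated squared error is bounded by bias and variance. -/
lemma mise_le {N M : ℕ} (hM : 1 ≤ M) (z : Fin d → ℕ) {lam : ℝ} (hlam : 0 < lam)
    {f : (Fin d → ℝ) → ℝ} (hf0 : ∀ x, 0 ≤ f x) (hf1 : ∫ x in cube d, f x = 1)
    (hf : MemRKHS ρ f) {Ω : Type*} [MeasurableSpace Ω] (P : Measure Ω) [IsProbabilityMeasure P]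
    (Y : Fin M → Ω → Fin d → ℝ) (hY : IsSample P f Y) (fhat : Ω → (Fin d → ℝ) → ℝ)
    (hfhat : ∀ ω, IsEstimator ρ N z lam (fun m => Y m ω) (fhat ω)) :
    ∃ u ∈ approxSpace ρ N z,
      (∀ v ∈ approxSpace ρ N z, l2Inner u v + lam * rkhsInner ρ u v = l2Inner f v) ∧
      mise P fhat f ≤ ENNReal.ofReal (2 * l2Inner (u - f) (u - f)
        + 2 * (1 / M * ∑' h, ρ h / (ρ h + lam))) := by
  set V := approxSpace ρ N z with hV
  set T := ∑' h, ρ h / (ρ h + lam) with hT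
  have hVE : V ≤ rkhs ρ hρ := approxSpace_le hρ hs he N z
  have hfE : f ∈ rkhs ρ hρ := hf
  have hK := isPosForm_rkhsInner hρ
  have hL := isPosForm_l2Inner hρ
  have hA := (hL.add_mul hK hlam.le).mono hVE
  obtain ⟨n, φ, hφ, hon, hexp⟩ := hA.exists_orthonormal fun v hv h0 => by
    refine MemRKHS.eq_zero hρ hs (hVE hv) ?_
    have h1 := hL.nonneg v (hVE hv)
    have h2 := hK.nonneg v (hVE hv)
    have h3 : lam * rkhsInner ρ v v = 0 := le_antisymm (by linarith) (mul_nonneg hlam.le h2)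
    exact (mul_eq_zero.1 h3).resolve_left hlam.ne'
  have hφE : ∀ i, MemRKHS ρ (φ i) := fun i => hVE (hφ i)
  have hdiag : ∀ x, ∑ i, φ i x ^ 2 ≤ T := by
    intro x
    -- The representer in `V` of evaluation at `x` for `A`. Both `v(x)` and `A(v,v)` equal `s = ∑
    -- φ_i(x)²`, so the evaluation bound reads `s² ≤ T s`.
    set v := ∑ i, φ i x • φ i with hv
    have hvV : v ∈ V := Submodule.sum_mem _ fun i _ => Submodule.smul_mem _ _ (hφ i)
    have h1 : v x = ∑ i, φ i x ^ 2 := by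
      rw [hv, Finset.sum_apply]
      simp [sq]
    have h2 := MemRKHS.sq_le hρ hs hlam (hVE hvV) x
    have h3 := hA.self_eq_sum_sq hφ hon (fun i => φ i x)
    rw [← hv] at h3
    rw [h3, h1, sq, ← hT] at h2
    have h4 : 0 ≤ ∑ i, φ i x ^ 2 := Finset.sum_nonneg fun i _ => sq_nonneg _
    rcases h4.eq_or_lt with h5 | h5
    · rw [← h5]
      exact tsum_nonneg fun h => div_nonneg (hρ h) (by linarith [hρ h])
    · exact le_of_mul_le_mul_right h2 h5
  set u := ∑ i, l2Inner f (φ i) • φ i with hu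
  have huV : u ∈ V := Submodule.sum_mem _ fun i _ => Submodule.smul_mem _ _ (hφ i)
  have huA : ∀ v ∈ V, l2Inner u v + lam * rkhsInner ρ u v = l2Inner f v := by
    intro v hv
    have h1 := hA.sum_smul_left Finset.univ (fun i => l2Inner f (φ i)) φ hφ hv
    rw [← hu] at h1
    rw [h1]
    conv_rhs => rw [hexp v hv]
    rw [hL.symm _ hfE _ (Submodule.sum_mem _ fun i _ => Submodule.smul_mem _ _ (hφE i)),
      hL.sum_smul_left _ _ _ hφE hfE]
    refine Finset.sum_congr rfl fun i _ => ?_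
    rw [hA.symm _ (hφ i) _ hv, hL.symm _ (hφE i) _ hfE, mul_comm]
  refine ⟨u, huV, huA, ?_⟩
  let c : Fin n → Ω → ℝ := fun i ω => 1 / (M : ℝ) * ∑ m, φ i (Y m ω) - l2Inner f (φ i)
  -- Testing both defining equations with `φ_i` gives the `A`-coefficients of the difference.
  have hest : ∀ ω, fhat ω - u = ∑ i, c i ω • φ i := by
    intro ω
    obtain ⟨hg, hgA⟩ := hfhat ω
    rw [hexp _ hg, hu, ← Finset.sum_sub_distrib]
    refine Finset.sum_congr rfl fun i _ => ?_
    rw [hgA _ (hφ i), ← sub_smul]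
  have hpt : ∀ ω, l2Inner (fhat ω - f) (fhat ω - f)
      ≤ 2 * l2Inner (u - f) (u - f) + 2 * ∑ i, c i ω ^ 2 := by
    intro ω
    have hg := (hfhat ω).1
    have hgu : fhat ω - u ∈ V := Submodule.sub_mem _ hg huV
    have h1 := hL.add_self_le (hVE hgu) (Submodule.sub_mem _ (hVE huV) hfE)
    rw [sub_add_sub_cancel] at h1
    have h2 := hA.self_eq_sum_sq hφ hon fun i => c i ω
    rw [← hest ω] at h2
    have h3 := mul_nonneg hlam.le (hK.nonneg _ (hVE hgu))
    linarith
  have hci := fun i => integral_sq_sampleMean_le hM hf.continuous hf0 hY (hφE i).continuous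
    ((hφE i).abs_le hρ hs)
  have hcint : ∀ i, Integrable (fun ω => c i ω ^ 2) P := fun i => (hci i).1
  have hint : Integrable (fun ω => 2 * l2Inner (u - f) (u - f) + 2 * ∑ i, c i ω ^ 2) P :=
    (integrable_const _).add ((integrable_finsetSum _ fun i _ => hcint i).const_mul 2)
  have hinner : ∀ ω, ∫⁻ x in cube d, ENNReal.ofReal (|fhat ω x - f x| ^ 2)
      = ENNReal.ofReal (l2Inner (fhat ω - f) (fhat ω - f)) := by
    intro ω
    have hcont : Continuous (fhat ω) := MemRKHS.continuous (hVE (hfhat ω).1)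
    have hfc := hf.continuous
    rw [← ofReal_integral_eq_lintegral_ofReal]
    · simp only [sq_abs]
      simp only [sq, l2Inner, Pi.sub_apply]
    · exact integrableOn_cube (by fun_prop)
    · exact Filter.Eventually.of_forall fun x => by positivity
  unfold mise
  simp only [hinner]
  calc ∫⁻ ω, ENNReal.ofReal (l2Inner (fhat ω - f) (fhat ω - f)) ∂P
      ≤ ∫⁻ ω, ENNReal.ofReal (2 * l2Inner (u - f) (u - f) + 2 * ∑ i, c i ω ^ 2) ∂P :=
        lintegral_mono fun ω => ENNReal.ofReal_le_ofReal (hpt ω)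
    _ = ENNReal.ofReal (∫ ω, (2 * l2Inner (u - f) (u - f) + 2 * ∑ i, c i ω ^ 2) ∂P) := by
        rw [← ofReal_integral_eq_lintegral_ofReal hint]
        refine Filter.Eventually.of_forall fun ω => ?_
        have := hL.nonneg _ (Submodule.sub_mem _ (hVE huV) hfE)
        simp only [Pi.zero_apply]
        positivity
    _ ≤ _ := by
        refine ENNReal.ofReal_le_ofReal ?_
        rw [integral_add (integrable_const _)
          ((integrable_finsetSum _ fun i _ => hcint i).const_mul 2), integral_const,
          integral_const_mul, integral_finsetSum _ fun i _ => hcint i, probReal_univ, one_smul]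
        gcongr
        calc ∑ i, ∫ ω, c i ω ^ 2 ∂P
            ≤ ∑ i, 1 / (M : ℝ) * l2Inner f (fun x => φ i x ^ 2) :=
              Finset.sum_le_sum fun i _ => (hci i).2
          _ = 1 / (M : ℝ) * ∫ x in cube d, f x * ∑ i, φ i x ^ 2 := by
              rw [← Finset.mul_sum]
              congr 1
              simp only [l2Inner, Finset.mul_sum]
              rw [integral_finsetSum]
              intro i _
              have h1 := hf.continuous
              have h2 := (hφE i).continuous
              exact integrableOn_cube (by fun_prop)
          -- The diagonal bound is uniform in `x`, so only `∫ f = 1` is needed of the density.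
          _ ≤ 1 / (M : ℝ) * ∫ x in cube d, f x * T := by
              have h1 := hf.continuous
              have h2 := fun i => (hφE i).continuous
              gcongr
              · exact integrableOn_cube (by fun_prop)
              · exact integrableOn_cube (by fun_prop)
              · exact measurableSet_cube.nullMeasurableSet
              · exact hf0 _
              · exact hdiag _
          _ = 1 / (M : ℝ) * T := by rw [integral_mul_const, hf1, one_mul]

end Mise

/-! ### Quality of component-by-component lattices. -/

section CBC

open scoped ENNReal

/-- Subadditivity of `x ↦ x^μ` for `μ ≤ 1` passes from finite sums to the limit by continuity. -/
lemma ennreal_rpow_tsum_le {ι : Type*} {μ : ℝ} (h0 : 0 < μ) (h1 : μ ≤ 1) (f : ι → ℝ≥0∞) :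
    (∑' i, f i) ^ μ ≤ ∑' i, f i ^ μ := by
  have hfin : ∀ s : Finset ι, (∑ i ∈ s, f i) ^ μ ≤ ∑ i ∈ s, f i ^ μ := by
    classical
    intro s
    induction s using Finset.induction_on with
    | empty => simp [h0]
    | insert i s hi ih =>
      rw [Finset.sum_insert hi, Finset.sum_insert hi]
      exact (ENNReal.rpow_add_le_add_rpow _ _ h0.le h1).trans (add_le_add le_rfl ih)
  refine le_of_tendsto ((ENNReal.continuous_rpow_const (y := μ)).continuousAt.tendsto.comp
    (ENNReal.summable (f := f)).hasSum) (Filter.Eventually.of_forall fun s => ?_)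
  exact (hfin s).trans (ENNReal.sum_le_tsum s)

/-- The constant `∑_{q ∈ ℤ} ((1 + |q|) / 8)^{-β}`. -/
def residueConst (β : ℝ) : ℝ := ∑' q : ℤ, ((1 + |(q : ℝ)|) / 8) ^ (-β)

lemma summable_residueConst {β : ℝ} (hβ : 1 < β) :
    Summable fun q : ℤ => ((1 + |(q : ℝ)|) / 8) ^ (-β) := by
  have h1 : Summable fun q : ℤ => |(q : ℝ)| ^ (-β) := Real.summable_abs_int_rpow hβ
  have h2 : Summable fun q : ℤ => (8 : ℝ) ^ β * |(q : ℝ)| ^ (-β) := h1.mul_left _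
  refine Summable.of_norm_bounded_eventually h2 ?_
  -- The comparison fails at `q = 0`, where `0 ^ (-β) = 0`, so that one term is discarded.
  have h3 : ({0} : Set ℤ)ᶜ ∈ (Filter.cofinite : Filter ℤ) := (Set.finite_singleton 0).compl_mem_cofinite
  filter_upwards [h3] with q hq
  have hq0 : 0 < |(q : ℝ)| := abs_pos.2 (by exact_mod_cast hq)
  rw [Real.norm_of_nonneg (by positivity), Real.div_rpow (by positivity) (by norm_num),
    Real.rpow_neg (by norm_num : (0 : ℝ) ≤ 8), div_inv_eq_mul, mul_comm]
  refine mul_le_mul_of_nonneg_left ?_ (by positivity)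
  exact Real.rpow_le_rpow_of_nonpos hq0 (by linarith) (by linarith)

lemma residueConst_nonneg (β : ℝ) : 0 ≤ residueConst β := tsum_nonneg fun q => by positivity

/-- Used to index a residue class modulo `N` by the floor quotient: members of size at least `N/2`
grow like `N` times one plus the size of that quotient. -/
lemma le_abs_of_residue {N k : ℤ} (hN : 0 < N) (hk : N ≤ 2 * |k|) :
    N * (1 + |k / N|) ≤ 8 * |k| := by
  have h1 := Int.emod_add_mul_ediv k N
  have h2 := Int.emod_nonneg k hN.ne'
  have h3 := Int.emod_lt_of_pos k hN
  set q := k / N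
  rcases le_or_gt 0 q with hq | hq
  · rw [abs_of_nonneg hq]
    have : 0 ≤ N * q := mul_nonneg hN.le hq
    rw [abs_of_nonneg (by linarith)] at *
    nlinarith
  · rw [abs_of_neg hq]
    have h4 : N * (q + 1) ≤ 0 := mul_nonpos_of_nonneg_of_nonpos hN.le (by omega)
    have h5 : k < 0 := by nlinarith
    rw [abs_of_neg h5] at *
    nlinarith

open Classical in
lemma tsum_residue_le {β : ℝ} (hβ : 1 < β) {N : ℕ} (hN : 0 < N) (r : ℤ) :
    ∑' k : ℤ, (if (N : ℤ) ∣ k - r ∧ (N : ℤ) ≤ 2 * |k| then ENNReal.ofReal (|(k : ℝ)| ^ (-β)) else 0)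
      ≤ ENNReal.ofReal (residueConst β / N) := by
  have hN0 : (0 : ℝ) < N := by exact_mod_cast hN
  have hN1 : (1 : ℝ) ≤ N := by exact_mod_cast hN
  let S : Set ℤ := {k | (N : ℤ) ∣ k - r}
  have hinj : Function.Injective fun k : S => (k : ℤ) / (N : ℤ) := by
    rintro ⟨k, hk⟩ ⟨l, hl⟩ h
    simp only at h
    have h1 : (N : ℤ) ∣ k - l := by
      have := dvd_sub hk hl
      simpa using this
    have h2 : k % N = l % N := (Int.modEq_iff_dvd.2 h1).symm
    have h3 := Int.emod_add_mul_ediv k N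
    have h4 := Int.emod_add_mul_ediv l N
    apply Subtype.ext
    simp only
    rw [← h3, ← h4, h2, h]
  calc _ ≤ ∑' k : ℤ, S.indicator (fun k => ENNReal.ofReal
        ((N : ℝ) ^ (-β) * ((1 + |((k / N : ℤ) : ℝ)|) / 8) ^ (-β))) k := by
        refine ENNReal.tsum_le_tsum fun k => ?_
        split_ifs with hk
        · rw [Set.indicator_of_mem (show k ∈ S from hk.1)]
          refine ENNReal.ofReal_le_ofReal ?_
          rw [← Real.mul_rpow hN0.le (by positivity)]
          refine Real.rpow_le_rpow_of_nonpos (by positivity) ?_ (by linarith)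
          have h1 := le_abs_of_residue (by exact_mod_cast hN) hk.2
          have h2 : (N : ℝ) * (1 + |((k / N : ℤ) : ℝ)|) ≤ 8 * |(k : ℝ)| := by exact_mod_cast h1
          linarith
        · exact zero_le
    _ = ∑' k : S, ENNReal.ofReal ((N : ℝ) ^ (-β) * ((1 + |(((k : ℤ) / N : ℤ) : ℝ)|) / 8) ^ (-β)) :=
        (tsum_subtype S _).symm
    _ ≤ ∑' q : ℤ, ENNReal.ofReal ((N : ℝ) ^ (-β) * ((1 + |(q : ℝ)|) / 8) ^ (-β)) :=
        ENNReal.tsum_comp_le_tsum_of_injective hinj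
          fun q : ℤ => ENNReal.ofReal ((N : ℝ) ^ (-β) * ((1 + |(q : ℝ)|) / 8) ^ (-β))
    _ = ENNReal.ofReal ((N : ℝ) ^ (-β) * residueConst β) := by
        rw [residueConst, ← tsum_mul_left, ENNReal.ofReal_tsum_of_nonneg (fun q => by positivity)
          ((summable_residueConst hβ).mul_left _)]
    _ ≤ _ := by
        refine ENNReal.ofReal_le_ofReal ?_
        rw [div_eq_inv_mul]
        refine mul_le_mul_of_nonneg_right ?_ (residueConst_nonneg β)
        rw [← Real.rpow_neg_one]
        exact Real.rpow_le_rpow_of_exponent_le hN1 (by linarith)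

variable {d : ℕ}

/-- `s` is the last coordinate in which `h` and `h'` differ. -/
def IsLastDiff (h h' : Fin d → ℤ) (s : Fin d) : Prop := h' s ≠ h s ∧ ∀ j, s < j → h' j = h j

lemma IsLastDiff.unique {h h' : Fin d → ℤ} {s t : Fin d} (hs : IsLastDiff h h' s)
    (ht : IsLastDiff h h' t) : s = t := by
  rcases lt_trichotomy s t with hst | hst | hst
  · exact absurd (hs.2 t hst) ht.1
  · exact hst
  · exact absurd (ht.2 s hst) hs.1

lemma IsLastDiff.symm {h h' : Fin d → ℤ} {s : Fin d} (hs : IsLastDiff h h' s) :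
    IsLastDiff h' h s := ⟨hs.1.symm, fun j hj => (hs.2 j hj).symm⟩

open Classical in
-- Each `h'` is counted for at most one `s`; this is what avoids a factor `d`.
lemma sum_tsum_isLastDiff_le (h : Fin d → ℤ) (a : (Fin d → ℤ) → ℝ≥0∞) :
    ∑ s, ∑' h', (if IsLastDiff h h' s then a h' else 0) ≤ ∑' h', a h' := by
  rw [← Summable.tsum_finsetSum fun _ _ => ENNReal.summable]
  refine ENNReal.tsum_le_tsum fun h' => ?_
  by_cases hex : ∃ s, IsLastDiff h h' s
  · obtain ⟨s, hs⟩ := hex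
    rw [Finset.sum_eq_single s]
    · rw [if_pos hs]
    · intro t _ hts
      rw [if_neg fun ht => hts (ht.unique hs)]
    · simp
  · push Not at hex
    simp [hex]

open Classical in
/-- The part of the double sum where the leading differences are multiples of `N`. -/
lemma sum_tsum_dvd_le {β : ℝ} (hβ : 1 < β) {N : ℕ} (hN : 0 < N) (a : (Fin d → ℤ) → ℝ≥0∞)
    (ha : ∀ (h : Fin d → ℤ) (s : Fin d) (k e : ℤ), k ≠ 0 → |e| = 1 →
      a (Function.update h s k) = a (Function.update h s e) * ENNReal.ofReal (|(k : ℝ)| ^ (-β)))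
    (h : Fin d → ℤ) :
    ∑ s, ∑' h', (if IsLastDiff h h' s ∧ (N : ℤ) ∣ h' s - h s ∧ |h s| ≤ |h' s| then a h' else 0)
      ≤ ENNReal.ofReal (residueConst β / N) * ∑' h', a h' := by
  have key : ∀ s : Fin d,
      ∑' h', (if IsLastDiff h h' s ∧ (N : ℤ) ∣ h' s - h s ∧ |h s| ≤ |h' s| then a h' else 0)
        ≤ ENNReal.ofReal (residueConst β / N) *
          ∑' h', (if IsLastDiff h h' s then a h' else 0) := by
    intro s
    -- A reference value of modulus 1 differing from `h s`: putting it into coordinate `s` of `h'`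
    -- keeps `s` the last difference, and `a` then splits off the factor `|h' s|^{-β}`.
    obtain ⟨e, he1, heh⟩ : ∃ e : ℤ, |e| = 1 ∧ e ≠ h s := by
      by_cases h1 : h s = 1
      · exact ⟨-1, by simp, by omega⟩
      · exact ⟨1, by simp, fun h2 => h1 h2.symm⟩
    let Φ : (Fin d → ℤ) → (Fin d → ℤ) × ℤ := fun h' => (Function.update h' s e, h' s)
    have hΦ : Function.Injective Φ := by
      intro x y hxy
      simp only [Φ, Prod.mk.injEq] at hxy
      have := congrArg (fun u => Function.update u s (x s)) hxy.1
      simp only [Function.update_idem] at this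
      rw [Function.update_eq_self] at this
      rw [this, hxy.2, Function.update_eq_self]
    let F : (Fin d → ℤ) × ℤ → ℝ≥0∞ := fun p =>
      (if IsLastDiff h p.1 s then a p.1 else 0) *
        (if (N : ℤ) ∣ p.2 - h s ∧ (N : ℤ) ≤ 2 * |p.2| then ENNReal.ofReal (|(p.2 : ℝ)| ^ (-β)) else 0)
    calc _ ≤ ∑' h', F (Φ h') := by
          refine ENNReal.tsum_le_tsum fun h' => ?_
          split_ifs with hc
          · obtain ⟨⟨hc1, hc2⟩, hc3, hc4⟩ := hc
            have h1 : IsLastDiff h (Function.update h' s e) s :=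
              ⟨by rwa [Function.update_self], fun j hj => by
                rw [Function.update_of_ne hj.ne']; exact hc2 j hj⟩
            -- A nonzero multiple of `N` separates `h s` and `h' s`, and `h' s` is the larger in
            -- modulus.
            have h2 : (N : ℤ) ≤ 2 * |h' s| := by
              have h3 : (N : ℤ) ≤ |h' s - h s| := by
                have := Int.le_of_dvd (abs_pos.2 (sub_ne_zero.2 hc1)) ((dvd_abs _ _).2 hc3)
                exact this
              have h4 := abs_sub (h' s) (h s)
              linarith
            have h5 : h' s ≠ 0 := by
              intro h0
              rw [h0, abs_zero] at h2
              omega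
            simp only [F, Φ, if_pos h1, if_pos (And.intro hc3 h2)]
            rw [← ha h' s (h' s) e h5 he1, Function.update_eq_self]
          · exact zero_le
      _ ≤ ∑' p, F p := ENNReal.tsum_comp_le_tsum_of_injective hΦ F
      _ = (∑' h', (if IsLastDiff h h' s then a h' else 0)) * ∑' k : ℤ,
          (if (N : ℤ) ∣ k - h s ∧ (N : ℤ) ≤ 2 * |k| then ENNReal.ofReal (|(k : ℝ)| ^ (-β)) else 0) := by
          rw [ENNReal.tsum_prod']
          simp only [F, ENNReal.tsum_mul_left, ENNReal.tsum_mul_right]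
      _ ≤ _ := by
          rw [mul_comm]
          gcongr
          exact tsum_residue_le hβ hN (h s)
  calc _ ≤ ∑ s, ENNReal.ofReal (residueConst β / N) *
          ∑' h', (if IsLastDiff h h' s then a h' else 0) := Finset.sum_le_sum fun s _ => key s
    _ ≤ _ := by
        rw [← Finset.mul_sum]
        gcongr
        exact sum_tsum_isLastDiff_le h a

open Classical in
-- The larger of `|h s|`, `|h' s|` may belong to either vector; exchanging them accounts for the
-- factor 2.
lemma sum_tsum_tsum_dvd_le {β : ℝ} (hβ : 1 < β) {N : ℕ} (hN : 0 < N) (a : (Fin d → ℤ) → ℝ≥0∞)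
    (ha : ∀ (h : Fin d → ℤ) (s : Fin d) (k e : ℤ), k ≠ 0 → |e| = 1 →
      a (Function.update h s k) = a (Function.update h s e) * ENNReal.ofReal (|(k : ℝ)| ^ (-β))) :
    ∑ s, ∑' h, ∑' h', (if IsLastDiff h h' s ∧ (N : ℤ) ∣ h' s - h s then a h * a h' else 0)
      ≤ 2 * (ENNReal.ofReal (residueConst β / N) * (∑' h, a h) ^ 2) := by
  let G : Fin d → (Fin d → ℤ) → (Fin d → ℤ) → ℝ≥0∞ := fun s h h' =>
    a h * if IsLastDiff h h' s ∧ (N : ℤ) ∣ h' s - h s ∧ |h s| ≤ |h' s| then a h' else 0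
  have h1 : ∀ s h h', (if IsLastDiff h h' s ∧ (N : ℤ) ∣ h' s - h s then a h * a h' else 0)
      ≤ G s h h' + G s h' h := by
    intro s h h'
    split_ifs with hc
    · rcases le_total |h s| |h' s| with hle | hle
      · refine le_add_right ?_
        simp only [G, if_pos (And.intro hc.1 (And.intro hc.2 hle)), le_refl]
      · refine le_add_left ?_
        have h2 : (N : ℤ) ∣ h s - h' s := by
          rw [← neg_sub]
          exact (dvd_neg).2 hc.2
        simp only [G, if_pos (And.intro hc.1.symm (And.intro h2 hle)), mul_comm, le_refl]
    · exact zero_le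
  have h2 : ∑ s, ∑' h, ∑' h', G s h h'
      ≤ ENNReal.ofReal (residueConst β / N) * (∑' h, a h) ^ 2 := by
    rw [← Summable.tsum_finsetSum fun _ _ => ENNReal.summable]
    calc _ ≤ ∑' h, a h * (ENNReal.ofReal (residueConst β / N) * ∑' h', a h') := by
          refine ENNReal.tsum_le_tsum fun h => ?_
          simp only [G, ENNReal.tsum_mul_left]
          rw [← Finset.mul_sum]
          gcongr
          exact sum_tsum_dvd_le hβ hN a ha h
      _ = _ := by
          rw [ENNReal.tsum_mul_right]
          ring
  calc _ ≤ ∑ s, ∑' h, ∑' h', (G s h h' + G s h' h) :=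
        Finset.sum_le_sum fun s _ => ENNReal.tsum_le_tsum fun h => ENNReal.tsum_le_tsum fun h' =>
          h1 s h h'
    _ = ∑ s, ∑' h, ∑' h', G s h h' + ∑ s, ∑' h, ∑' h', G s h h' := by
        rw [← Finset.sum_add_distrib]
        refine Finset.sum_congr rfl fun s _ => ?_
        simp only [ENNReal.tsum_add]
        congr 1
        exact ENNReal.tsum_comm
    _ ≤ _ := by
        rw [two_mul]
        exact add_le_add h2 h2

open Classical in
-- If `N ∤ l s`, the condition is a linear congruence in `a` with invertible leading coefficient, as
-- `N` is prime, so at most one residue solves it. Otherwise the trivial count `N - 1` is used.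
lemma card_filter_dvd_le {N : ℕ} (hN : N.Prime) (l : Fin d → ℤ) (z : Fin d → ℕ) (s : Fin d) :
    (((Finset.Icc 1 (N - 1)).filter
      fun a => (N : ℤ) ∣ ∑ j, l j * ((Function.update z s a) j : ℤ)).card : ℝ≥0∞)
      ≤ 1 + ((N - 1 : ℕ) : ℝ≥0∞) * if (N : ℤ) ∣ l s then 1 else 0 := by
  split_ifs with hl
  · refine le_add_left ?_
    rw [mul_one]
    have := Finset.card_filter_le (Finset.Icc 1 (N - 1))
      (fun a => (N : ℤ) ∣ ∑ j, l j * ((Function.update z s a) j : ℤ))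
    rw [Nat.card_Icc, Nat.add_sub_cancel] at this
    exact_mod_cast this
  · rw [mul_zero, add_zero]
    have : ((Finset.Icc 1 (N - 1)).filter
        fun a => (N : ℤ) ∣ ∑ j, l j * ((Function.update z s a) j : ℤ)).card ≤ 1 := by
      rw [Finset.card_le_one]
      intro a ha b hb
      rw [Finset.mem_filter, Finset.mem_Icc] at ha hb
      have hsum : ∀ c : ℕ, ∑ j, l j * ((Function.update z s c) j : ℤ)
          = l s * c + ∑ j ∈ Finset.univ.erase s, l j * (z j : ℤ) := by
        intro c
        rw [← Finset.add_sum_erase _ _ (Finset.mem_univ s), Function.update_self]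
        congr 1
        refine Finset.sum_congr rfl fun j hj => ?_
        rw [Function.update_of_ne (Finset.ne_of_mem_erase hj)]
      have h1 := dvd_sub ha.2 hb.2
      rw [hsum, hsum, add_sub_add_right_eq_sub, ← mul_sub] at h1
      rcases (Nat.prime_iff_prime_int.1 hN).dvd_or_dvd h1 with h2 | h2
      · exact absurd h2 hl
      · have h3 : |(a : ℤ) - b| < N := by
          rw [abs_lt]
          omega
        have h4 := Int.eq_zero_of_abs_lt_dvd h2 h3
        omega
    exact_mod_cast this

open Classical in
/-- The quality of the vectors that the component-by-component construction produces. -/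
lemma latticeQuality_rpow_le {ρ : (Fin d → ℤ) → ℝ} (hρ : ∀ h, 0 ≤ ρ h) (hs : Summable ρ)
    {μ β : ℝ} (hμ0 : 0 < μ) (hμ1 : μ ≤ 1) (hβ : 1 < β) (hsμ : Summable fun h => ρ h ^ μ)
    (ha : ∀ (h : Fin d → ℤ) (s : Fin d) (k e : ℤ), k ≠ 0 → |e| = 1 →
      ρ (Function.update h s k) ^ μ = ρ (Function.update h s e) ^ μ * |(k : ℝ)| ^ (-β))
    {N : ℕ} (hN : N.Prime) {z : Fin d → ℕ} (hz : IsCBC ρ N z) :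
    latticeQuality ρ N z ^ μ ≤ (2 + 2 * residueConst β) / N * (∑' h, ρ h ^ μ) ^ 2 := by
  set a : (Fin d → ℤ) → ℝ≥0∞ := fun h => ENNReal.ofReal (ρ h ^ μ) with hadef
  have ha0 : ∀ h, 0 ≤ ρ h ^ μ := fun h => Real.rpow_nonneg (hρ h) μ
  have ha' : ∀ (h : Fin d → ℤ) (s : Fin d) (k e : ℤ), k ≠ 0 → |e| = 1 →
      a (Function.update h s k) = a (Function.update h s e) * ENNReal.ofReal (|(k : ℝ)| ^ (-β)) := by
    intro h s k e hk he
    simp only [a]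
    rw [ha h s k e hk he, ENNReal.ofReal_mul (ha0 _)]
  set A : ℝ≥0∞ := ∑' h, a h with hA
  have hN1 : 1 ≤ N - 1 := by have := hN.two_le; omega
  let U : Fin d → ℝ≥0∞ := fun s => ∑' h, ∑' h', if IsLastDiff h h' s then a h * a h' else 0
  let D : Fin d → ℝ≥0∞ := fun s =>
    ∑' h, ∑' h', if IsLastDiff h h' s ∧ (N : ℤ) ∣ h' s - h s then a h * a h' else 0
  have hD : ∑ s, D s ≤ 2 * (ENNReal.ofReal (residueConst β / N) * A ^ 2) :=
    sum_tsum_tsum_dvd_le hβ hN.pos a ha'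
  have hU : ∑ s, U s ≤ A ^ 2 := by
    simp only [U]
    rw [← Summable.tsum_finsetSum fun _ _ => ENNReal.summable]
    calc _ ≤ ∑' h, a h * A := by
          refine ENNReal.tsum_le_tsum fun h => ?_
          have h1 : ∀ s h', (if IsLastDiff h h' s then a h * a h' else 0)
              = a h * if IsLastDiff h h' s then a h' else 0 := fun s h' => by
            rw [mul_ite, mul_zero]
          simp only [h1, ENNReal.tsum_mul_left]
          rw [← Finset.mul_sum]
          gcongr
          exact sum_tsum_isLastDiff_le h a
      _ = _ := by rw [ENNReal.tsum_mul_right, sq]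
  have hT : ∀ s (w : Fin d → ℕ), ENNReal.ofReal (cbcCriterion ρ N s w) ^ μ
      ≤ ∑' h, ∑' l : Fin d → ℤ, if l s ≠ 0 ∧ (∀ j, s < j → l j = 0) ∧
        (N : ℤ) ∣ ∑ j, l j * (w j : ℤ) then a h * a (h + l) else 0 := by
    intro s w
    rw [cbcCriterion, ENNReal.ofReal_tsum_of_nonneg (fun p => ?_) (summable_mul_shift_ite hρ hs _)]
    · refine (ennreal_rpow_tsum_le hμ0 hμ1 _).trans (le_of_eq ?_)
      rw [ENNReal.tsum_prod']
      refine tsum_congr fun h => tsum_congr fun l => ?_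
      split_ifs
      · rw [ENNReal.ofReal_rpow_of_nonneg (mul_nonneg (hρ _) (hρ _)) hμ0.le,
          Real.mul_rpow (hρ _) (hρ _), ENNReal.ofReal_mul (ha0 _)]
      · rw [ENNReal.ofReal_zero, ENNReal.zero_rpow_of_pos hμ0]
    · split_ifs
      exacts [mul_nonneg (hρ _) (hρ _), le_rfl]
  -- The minimal value is at most the mean over the `N - 1` candidates; exchanging sums leaves a
  -- count of candidates for each `l`.
  have hmean : ∀ s, ((N - 1 : ℕ) : ℝ≥0∞) * ENNReal.ofReal (cbcCriterion ρ N s z) ^ μ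
      ≤ U s + ((N - 1 : ℕ) : ℝ≥0∞) * D s := by
    intro s
    calc ((N - 1 : ℕ) : ℝ≥0∞) * ENNReal.ofReal (cbcCriterion ρ N s z) ^ μ
        = ∑ _b ∈ Finset.Icc 1 (N - 1), ENNReal.ofReal (cbcCriterion ρ N s z) ^ μ := by
          rw [Finset.sum_const, Nat.card_Icc, Nat.add_sub_cancel, nsmul_eq_mul]
      _ ≤ ∑ b ∈ Finset.Icc 1 (N - 1), ∑' h, ∑' l : Fin d → ℤ,
          if l s ≠ 0 ∧ (∀ j, s < j → l j = 0) ∧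
            (N : ℤ) ∣ ∑ j, l j * ((Function.update z s b) j : ℤ) then a h * a (h + l) else 0 := by
          refine Finset.sum_le_sum fun b hb => ?_
          refine le_trans ?_ (hT s (Function.update z s b))
          gcongr
          exact hz.2 s b hb
      _ = ∑' h, ∑' l : Fin d → ℤ, ∑ b ∈ Finset.Icc 1 (N - 1),
          if l s ≠ 0 ∧ (∀ j, s < j → l j = 0) ∧
            (N : ℤ) ∣ ∑ j, l j * ((Function.update z s b) j : ℤ) then a h * a (h + l) else 0 := by
          rw [← Summable.tsum_finsetSum fun _ _ => ENNReal.summable]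
          refine tsum_congr fun h => ?_
          rw [← Summable.tsum_finsetSum fun _ _ => ENNReal.summable]
      _ ≤ ∑' h, ∑' l : Fin d → ℤ, ((if IsLastDiff h (h + l) s then a h * a (h + l) else 0)
          + ((N - 1 : ℕ) : ℝ≥0∞) * if IsLastDiff h (h + l) s ∧ (N : ℤ) ∣ (h + l) s - h s
            then a h * a (h + l) else 0) := by
          refine ENNReal.tsum_le_tsum fun h => ENNReal.tsum_le_tsum fun l => ?_
          have h1 : IsLastDiff h (h + l) s ↔ l s ≠ 0 ∧ ∀ j, s < j → l j = 0 := by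
            simp [IsLastDiff]
          have h2 : (h + l) s - h s = l s := by simp
          rw [h1, h2]
          by_cases hc : l s ≠ 0 ∧ ∀ j, s < j → l j = 0
          · have h3 := card_filter_dvd_le hN l z s
            simp only [hc.1, eq_true hc.2, ne_eq, not_false_eq_true, true_and, if_true]
            rw [← Finset.sum_filter, Finset.sum_const, nsmul_eq_mul]
            refine (mul_le_mul_left h3 _).trans (le_of_eq ?_)
            rw [add_mul, one_mul, mul_assoc, ite_mul, one_mul, zero_mul]
          · rw [Finset.sum_eq_zero]
            · exact zero_le
            · intro b _
              rw [if_neg fun h4 => hc ⟨h4.1, h4.2.1⟩]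
      _ = U s + ((N - 1 : ℕ) : ℝ≥0∞) * D s := by
          simp only [ENNReal.tsum_add, ENNReal.tsum_mul_left, U, D]
          congr 1
          · refine tsum_congr fun h => ?_
            exact (Equiv.addLeft h).tsum_eq fun h' => if IsLastDiff h h' s then a h * a h' else 0
          · congr 1
            refine tsum_congr fun h => ?_
            exact (Equiv.addLeft h).tsum_eq fun h' =>
              if IsLastDiff h h' s ∧ (N : ℤ) ∣ h' s - h s then a h * a h' else 0
  have hsum : ENNReal.ofReal (latticeQuality ρ N z) ^ μ
      ≤ ∑ s, ENNReal.ofReal (cbcCriterion ρ N s z) ^ μ := by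
    rw [latticeQuality_eq_sum hρ hs,
      ENNReal.ofReal_sum_of_nonneg fun s _ => cbcCriterion_nonneg hρ N s z]
    have := ennreal_rpow_tsum_le hμ0 hμ1 fun s => ENNReal.ofReal (cbcCriterion ρ N s z)
    simpa only [tsum_fintype] using this
  have hfinal : ((N - 1 : ℕ) : ℝ≥0∞) * ENNReal.ofReal (latticeQuality ρ N z) ^ μ
      ≤ A ^ 2 + ((N - 1 : ℕ) : ℝ≥0∞) * (2 * (ENNReal.ofReal (residueConst β / N) * A ^ 2)) := by
    calc _ ≤ ∑ s, ((N - 1 : ℕ) : ℝ≥0∞) * ENNReal.ofReal (cbcCriterion ρ N s z) ^ μ := by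
          rw [← Finset.mul_sum]
          gcongr
      _ ≤ ∑ s, (U s + ((N - 1 : ℕ) : ℝ≥0∞) * D s) := Finset.sum_le_sum fun s _ => hmean s
      _ ≤ _ := by
          rw [Finset.sum_add_distrib, ← Finset.mul_sum]
          gcongr
  have hq0 : 0 ≤ latticeQuality ρ N z := by
    rw [latticeQuality_eq_sum hρ hs]
    exact Finset.sum_nonneg fun s _ => cbcCriterion_nonneg hρ N s z
  have hAr : A = ENNReal.ofReal (∑' h, ρ h ^ μ) := (ENNReal.ofReal_tsum_of_nonneg ha0 hsμ).symm
  set R := ∑' h, ρ h ^ μ with hR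
  have hR0 : 0 ≤ R := tsum_nonneg ha0
  have hc0 := residueConst_nonneg β
  have hNr : (0 : ℝ) < N := by exact_mod_cast hN.pos
  have hn : (((N - 1 : ℕ) : ℝ)) = N - 1 := by
    rw [Nat.cast_sub hN.one_le, Nat.cast_one]
  have h2N : (2 : ℝ) ≤ N := by exact_mod_cast hN.two_le
  rw [hAr, ENNReal.ofReal_rpow_of_nonneg hq0 hμ0.le, ← ENNReal.ofReal_natCast (N - 1),
    ← ENNReal.ofReal_pow hR0, show (2 : ℝ≥0∞) = ENNReal.ofReal 2 by simp,
    ← ENNReal.ofReal_mul (by positivity), ← ENNReal.ofReal_mul (by positivity),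
    ← ENNReal.ofReal_mul (by positivity), ← ENNReal.ofReal_mul (by positivity),
    ← ENNReal.ofReal_add (by positivity) (by positivity),
    ENNReal.ofReal_le_ofReal_iff (by positivity), hn] at hfinal
  have h1 : latticeQuality ρ N z ^ μ ≤ R ^ 2 / (N - 1) + 2 * (residueConst β / N * R ^ 2) := by
    have h3 : (0 : ℝ) < N - 1 := by linarith
    rw [← sub_le_iff_le_add, le_div_iff₀ h3]
    linarith
  refine h1.trans ?_
  -- `N ≤ 2(N - 1)` because `N ≥ 2`.
  have h4 : R ^ 2 / (N - 1) ≤ 2 / N * R ^ 2 := by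
    rw [div_mul_eq_mul_div, div_le_div_iff₀ (by linarith) hNr]
    nlinarith [sq_nonneg R]
  calc _ ≤ 2 / N * R ^ 2 + 2 * (residueConst β / N * R ^ 2) := by linarith
    _ = _ := by ring

end CBC

/-! ### Traces of the Korobov kernel and the weight conditions. -/

section Trace

variable {d : ℕ} {α : ℝ} {γ : Finset ℕ → ℝ}

lemma rInv_nonneg (hγ : ∀ w, 0 ≤ γ w) (h : Fin d → ℤ) : 0 ≤ rInv α γ h :=
  mul_nonneg (hγ _) (Finset.prod_nonneg fun _ _ => Real.rpow_nonneg (abs_nonneg _) _)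

lemma rInv_neg (h : Fin d → ℤ) : rInv α γ (-h) = rInv α γ h := by
  have : supp (-h) = supp h := by
    ext j
    simp [supp]
  simp [rInv, this]

lemma rInv_rpow (hγ : ∀ w, 0 ≤ γ w) (μ : ℝ) (h : Fin d → ℤ) :
    rInv α γ h ^ μ = γ ((supp h).map Fin.valEmbedding) ^ μ *
      ∏ j ∈ supp h, |(h j : ℝ)| ^ (-(α * μ)) := by
  rw [rInv, Real.mul_rpow (hγ _) (Finset.prod_nonneg fun _ _ => Real.rpow_nonneg (abs_nonneg _) _),
    ← Real.finsetProd_rpow _ _ fun _ _ => Real.rpow_nonneg (abs_nonneg _) _]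
  congr 1
  refine Finset.prod_congr rfl fun j _ => ?_
  rw [← Real.rpow_mul (abs_nonneg _), neg_mul]

/-- The weight sees only the support, so a nonzero coordinate enters through its power alone. This
is the factorization that the lattice estimate requires. -/
lemma rInv_update_rpow (hγ : ∀ w, 0 ≤ γ w) (μ : ℝ) (h : Fin d → ℤ) (s : Fin d) (k e : ℤ)
    (hk : k ≠ 0) (he : |e| = 1) :
    rInv α γ (Function.update h s k) ^ μ
      = rInv α γ (Function.update h s e) ^ μ * |(k : ℝ)| ^ (-(α * μ)) := by
  have hsupp : ∀ c : ℤ, c ≠ 0 → supp (Function.update h s c) = insert s (supp h) := by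
    intro c hc
    ext j
    rcases eq_or_ne j s with rfl | hj
    · simp [mem_supp, hc]
    · simp [mem_supp, hj]
  have hprod : ∀ c : ℤ, c ≠ 0 →
      ∏ j ∈ supp (Function.update h s c), |((Function.update h s c j : ℤ) : ℝ)| ^ (-(α * μ))
        = |(c : ℝ)| ^ (-(α * μ)) * ∏ j ∈ (insert s (supp h)).erase s, |(h j : ℝ)| ^ (-(α * μ)) := by
    intro c hc
    rw [hsupp c hc, ← Finset.mul_prod_erase _ _ (Finset.mem_insert_self s (supp h)),
      Function.update_self]
    congr 1
    refine Finset.prod_congr rfl fun j hj => ?_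
    rw [Function.update_of_ne (Finset.ne_of_mem_erase hj)]
  have he0 : e ≠ 0 := by
    rintro rfl
    simp at he
  have he1 : |(e : ℝ)| = 1 := by exact_mod_cast he
  rw [rInv_rpow hγ, rInv_rpow hγ, hprod k hk, hprod e he0, hsupp k hk, hsupp e he0, he1,
    Real.one_rpow]
  ring

/-- The trace `∑_h r(h,γ)^{-μ}`. -/
def korobovTrace (α : ℝ) (γ : Finset ℕ → ℝ) (μ : ℝ) (d : ℕ) : ℝ :=
  ∑' h : Fin d → ℤ, rInv α γ h ^ μ

lemma korobovTrace_nonneg (hγ : ∀ w, 0 ≤ γ w) (μ : ℝ) (d : ℕ) : 0 ≤ korobovTrace α γ μ d :=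
  tsum_nonneg fun h => Real.rpow_nonneg (rInv_nonneg hγ h) _

lemma sum_rInv_rpow_le (hγ : ∀ w, 0 ≤ γ w) {μ : ℝ} (hμ : 1 < α * μ) (F : Finset (Fin d → ℤ)) :
    ∑ h ∈ F, rInv α γ h ^ μ ≤ ∑ u : Finset (Fin d), γ (u.map Fin.valEmbedding) ^ μ *
      (∑' k : ℤ, |(k : ℝ)| ^ (-(α * μ))) ^ u.card := by
  classical
  set Z := ∑' k : ℤ, |(k : ℝ)| ^ (-(α * μ))
  have hZs : Summable fun k : ℤ => |(k : ℝ)| ^ (-(α * μ)) := Real.summable_abs_int_rpow hμ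
  -- For fixed `u` the product of these factors tests that `h` vanishes off `u` and carries the
  -- powers on `u`. It factorizes over coordinates, so box sums become products of one-dimensional
  -- sums.
  let g : Finset (Fin d) → Fin d → ℤ → ℝ := fun u j k =>
    if j ∈ u then |(k : ℝ)| ^ (-(α * μ)) else if k = 0 then 1 else 0
  have hg0 : ∀ u j k, 0 ≤ g u j k := by
    intro u j k
    simp only [g]
    split_ifs <;> positivity
  have hle : ∀ h : Fin d → ℤ, rInv α γ h ^ μ
      ≤ ∑ u : Finset (Fin d), γ (u.map Fin.valEmbedding) ^ μ * ∏ j, g u j (h j) := by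
    intro h
    refine le_trans (le_of_eq ?_) (Finset.single_le_sum
      (f := fun u : Finset (Fin d) => γ (u.map Fin.valEmbedding) ^ μ * ∏ j, g u j (h j))
      (fun u _ => mul_nonneg (Real.rpow_nonneg (hγ _) _) (Finset.prod_nonneg fun j _ => hg0 u j _))
      (Finset.mem_univ (supp h)))
    rw [rInv_rpow hγ]
    congr 1
    rw [← Finset.prod_subset (Finset.subset_univ (supp h))]
    · refine Finset.prod_congr rfl fun j hj => ?_
      simp only [g, if_pos hj]
    · intro j _ hj
      have h0 : h j = 0 := by
        by_contra h1
        exact hj (mem_supp.2 h1)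
      simp only [g, if_neg hj, h0, if_true]
  let box : Finset (Fin d → ℤ) := Fintype.piFinset fun j => F.image fun h => h j
  have hF : F ⊆ box := by
    intro h hh
    rw [Fintype.mem_piFinset]
    exact fun j => Finset.mem_image_of_mem _ hh
  calc ∑ h ∈ F, rInv α γ h ^ μ ≤ ∑ h ∈ box, rInv α γ h ^ μ :=
        Finset.sum_le_sum_of_subset_of_nonneg hF
          fun h _ _ => Real.rpow_nonneg (rInv_nonneg hγ h) _
    _ ≤ ∑ h ∈ box, ∑ u : Finset (Fin d), γ (u.map Fin.valEmbedding) ^ μ * ∏ j, g u j (h j) :=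
        Finset.sum_le_sum fun h _ => hle h
    _ = ∑ u : Finset (Fin d), γ (u.map Fin.valEmbedding) ^ μ *
          ∏ j, ∑ k ∈ F.image (fun h => h j), g u j k := by
        rw [Finset.sum_comm]
        refine Finset.sum_congr rfl fun u _ => ?_
        rw [← Finset.mul_sum, Finset.prod_univ_sum]
    _ ≤ _ := by
        refine Finset.sum_le_sum fun u _ => mul_le_mul_of_nonneg_left ?_
          (Real.rpow_nonneg (hγ _) _)
        calc ∏ j, ∑ k ∈ F.image (fun h => h j), g u j k ≤ ∏ j, if j ∈ u then Z else 1 := by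
              refine Finset.prod_le_prod (fun j _ => Finset.sum_nonneg fun k _ => hg0 u j k)
                fun j _ => ?_
              by_cases hj : j ∈ u
              · simp only [g, if_pos hj]
                exact hZs.sum_le_tsum _ fun k _ => Real.rpow_nonneg (abs_nonneg _) _
              · simp only [g, if_neg hj, Finset.sum_ite_eq']
                split_ifs <;> norm_num
          _ = Z ^ u.card := by
              rw [Finset.prod_ite_mem, Finset.univ_inter, Finset.prod_const]

lemma summable_rInv_rpow (hγ : ∀ w, 0 ≤ γ w) {μ : ℝ} (hμ : 1 < α * μ) :
    Summable fun h : Fin d → ℤ => rInv α γ h ^ μ :=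
  summable_of_sum_le (fun h => Real.rpow_nonneg (rInv_nonneg hγ h) _)
    fun F => sum_rInv_rpow_le hγ hμ F

lemma summable_rInv (hγ : ∀ w, 0 ≤ γ w) (hα : 1 < α) :
    Summable fun h : Fin d → ℤ => rInv α γ h := by
  have := summable_rInv_rpow (d := d) hγ (α := α) (μ := 1) (by simpa using hα)
  simpa only [Real.rpow_one] using this

lemma two_mul_zeta_eq {β : ℝ} (hβ : 1 < β) :
    2 * (riemannZeta (β : ℂ)).re = ∑' k : ℤ, |(k : ℝ)| ^ (-β) := by
  have h1 : HasSum (fun n : ℕ => (n : ℝ) ^ (-β)) (∑' n : ℕ, (n : ℝ) ^ (-β)) :=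
    (Real.summable_nat_rpow.2 (by linarith)).hasSum
  have h2 : (riemannZeta (β : ℂ)).re = ∑' n : ℕ, (n : ℝ) ^ (-β) := by
    rw [zeta_eq_tsum_one_div_nat_cpow (by simpa using hβ)]
    have h3 : ∀ n : ℕ, (1 : ℂ) / (n : ℂ) ^ (β : ℂ) = (((n : ℝ) ^ (-β) : ℝ) : ℂ) := by
      intro n
      rw [Real.rpow_neg n.cast_nonneg, Complex.ofReal_inv, Complex.ofReal_cpow n.cast_nonneg,
        Complex.ofReal_natCast, one_div]
    simp only [h3]
    rw [← Complex.ofReal_tsum, Complex.ofReal_re]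
  have h4 : HasSum (fun k : ℤ => |(k : ℝ)| ^ (-β)) _ :=
    HasSum.of_nat_of_neg (f := fun k : ℤ => |(k : ℝ)| ^ (-β))
      (by simpa using h1) (by simpa using h1)
  -- The term at zero vanishes by the convention `0 ^ (-β) = 0`, hence the sum over `ℤ` is exactly
  -- twice the zeta series.
  rw [h4.tsum_eq, h2, Int.cast_zero, abs_zero, Real.zero_rpow (by linarith)]
  ring

/-- The trace is bounded in the dimension. -/
def TraceBounded (α : ℝ) (γ : Finset ℕ → ℝ) (μ : ℝ) : Prop :=
  ∃ B : ℝ, ∀ d, korobovTrace α γ μ d ≤ B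

lemma TraceSummable.traceBounded (hγ : ∀ w, 0 ≤ γ w) {μ : ℝ} (hμ : 1 < α * μ)
    (h : TraceSummable α μ γ) : TraceBounded α γ μ := by
  unfold TraceSummable at h
  rw [two_mul_zeta_eq hμ] at h
  have hZ : 0 ≤ ∑' k : ℤ, |(k : ℝ)| ^ (-(α * μ)) :=
    tsum_nonneg fun k => Real.rpow_nonneg (abs_nonneg _) _
  refine ⟨∑' w : Finset ℕ, γ w ^ μ * (∑' k : ℤ, |(k : ℝ)| ^ (-(α * μ))) ^ w.card,
    fun d => (Summable.tsum_le_of_sum_le (summable_rInv_rpow hγ hμ)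
    fun F => sum_rInv_rpow_le hγ hμ F).trans ?_⟩
  -- The subsets of the first `d` coordinates form a finite part of the family indexed by all finite
  -- subsets of `ℕ`.
  have h1 := h.sum_le_tsum
    (Finset.univ.map (Finset.mapEmbedding (Fin.valEmbedding (n := d))).toEmbedding)
    fun w _ => mul_nonneg (Real.rpow_nonneg (hγ w) μ) (pow_nonneg hZ _)
  rw [Finset.sum_map] at h1
  refine le_trans (le_of_eq (Finset.sum_congr rfl fun u _ => ?_)) h1
  simp

/-- Each term `ρ^μ` is at most the trace bound `B`, so `ρ^ν = (ρ^μ)^{ν/μ-1} ρ^μ ≤ B^{ν/μ-1} ρ^μ`. -/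
lemma TraceBounded.mono (hγ : ∀ w, 0 ≤ γ w) {μ ν : ℝ} (hα : 0 < α) (hμ : 1 < α * μ) (hμν : μ ≤ ν)
    (h : TraceBounded α γ μ) : TraceBounded α γ ν := by
  obtain ⟨B, hB⟩ := h
  have hμ0 : 0 < μ := by
    by_contra h0
    nlinarith [mul_nonneg hα.le (neg_nonneg.2 (not_lt.1 h0))]
  have hp : 1 ≤ ν / μ := (one_le_div hμ0).2 hμν
  have hB0 : 0 ≤ B := (korobovTrace_nonneg hγ μ 0).trans (hB 0)
  refine ⟨B ^ (ν / μ - 1) * B, fun d => ?_⟩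
  have hs := summable_rInv_rpow (d := d) hγ hμ
  have hν : 1 < α * ν := lt_of_lt_of_le hμ (mul_le_mul_of_nonneg_left hμν hα.le)
  have hle : ∀ h : Fin d → ℤ, rInv α γ h ^ ν ≤ B ^ (ν / μ - 1) * rInv α γ h ^ μ := by
    intro h
    have hx0 : 0 ≤ rInv α γ h ^ μ := Real.rpow_nonneg (rInv_nonneg hγ h) _
    have hxB : rInv α γ h ^ μ ≤ B :=
      (hs.le_tsum h fun k _ => Real.rpow_nonneg (rInv_nonneg hγ k) _).trans (hB d)
    have h1 : rInv α γ h ^ ν = (rInv α γ h ^ μ) ^ (ν / μ - 1) * rInv α γ h ^ μ := by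
      have h2 := Real.rpow_add_of_nonneg hx0 (sub_nonneg.2 hp) zero_le_one
      rw [sub_add_cancel, Real.rpow_one, ← Real.rpow_mul (rInv_nonneg hγ h),
        mul_div_cancel₀ _ hμ0.ne'] at h2
      exact h2
    rw [h1]
    exact mul_le_mul_of_nonneg_right (Real.rpow_le_rpow hx0 hxB (by linarith)) hx0
  calc korobovTrace α γ ν d ≤ ∑' h : Fin d → ℤ, B ^ (ν / μ - 1) * rInv α γ h ^ μ :=
        (summable_rInv_rpow hγ hν).tsum_le_tsum hle (hs.mul_left _)
    _ = B ^ (ν / μ - 1) * korobovTrace α γ μ d := tsum_mul_left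
    _ ≤ _ := mul_le_mul_of_nonneg_left (hB d) (Real.rpow_nonneg hB0 _)

lemma WeightSummable.traceSummable (hγ : ∀ w, 0 ≤ γ w) {δ : ℝ} (hδ : 0 < δ) (hδα : δ < α / 4)
    (h : WeightSummable α δ γ) : TraceSummable α (1 / (α - 4 * δ)) γ := by
  have h0 : 0 < α - 4 * δ := by linarith
  have h1 : 1 < α / (α - 4 * δ) := (one_lt_div h0).2 (by linarith)
  have hZ : 0 ≤ 2 * (riemannZeta ((α / (α - 4 * δ) : ℝ) : ℂ)).re := by
    rw [two_mul_zeta_eq h1]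
    exact tsum_nonneg fun k => Real.rpow_nonneg (abs_nonneg _) _
  unfold TraceSummable
  rw [mul_one_div]
  refine Summable.of_nonneg_of_le (fun w => ?_) (fun w => ?_) h
  · exact mul_nonneg (Real.rpow_nonneg (hγ w) _) (pow_nonneg hZ _)
  · rw [mul_assoc]
    exact le_mul_of_one_le_left (mul_nonneg (Real.rpow_nonneg (hγ w) _) (pow_nonneg hZ _))
      (le_max_right _ _)

/-- Squaring `ρ` doubles the smoothness and squares the weights, so the trace of `ρ²` at `ν` is that
of `ρ` at `2ν`. -/
lemma TraceSummable.of_sq (hγ : ∀ w, 0 ≤ γ w) {ν : ℝ}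
    (h : TraceSummable (2 * α) ν fun w => γ w ^ 2) : TraceSummable α (2 * ν) γ := by
  unfold TraceSummable at h ⊢
  refine h.congr fun w => ?_
  have h1 : (γ w ^ 2) ^ ν = γ w ^ (2 * ν) := by
    rw [Real.rpow_mul (hγ w), Real.rpow_two]
  rw [h1, show 2 * α * ν = α * (2 * ν) by ring]

/-- The effective dimension is controlled by the trace. -/
lemma tsum_div_add_le (hγ : ∀ w, 0 ≤ γ w) {τ lam : ℝ} (hτα : 1 < α * τ)
    (hτ0 : 0 ≤ τ) (hτ : τ ≤ 1) (hlam : 0 < lam) (d : ℕ) :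
    ∑' h : Fin d → ℤ, rInv α γ h / (rInv α γ h + lam) ≤ korobovTrace α γ τ d / lam ^ τ := by
  have hle : ∀ h : Fin d → ℤ, rInv α γ h / (rInv α γ h + lam) ≤ rInv α γ h ^ τ / lam ^ τ := by
    intro h
    have hr := rInv_nonneg (α := α) hγ h
    rw [← Real.div_rpow hr hlam.le]
    set r := rInv α γ h
    -- `r/(r+λ) ≤ min(1, r/λ) ≤ (r/λ)^τ` for `0 ≤ τ ≤ 1`.
    rcases le_total r lam with h1 | h1
    · calc r / (r + lam) ≤ r / lam := div_le_div_of_nonneg_left hr hlam (by linarith)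
        _ = (r / lam) ^ (1 : ℝ) := (Real.rpow_one _).symm
        _ ≤ (r / lam) ^ τ := Real.rpow_le_rpow_of_exponent_ge' (div_nonneg hr hlam.le)
            ((div_le_one hlam).2 h1) hτ0 hτ
    · calc r / (r + lam) ≤ 1 := (div_le_one (by linarith)).2 (by linarith)
        _ ≤ (r / lam) ^ τ := Real.one_le_rpow ((one_le_div hlam).2 h1) hτ0
  have hs := (summable_rInv_rpow (d := d) hγ hτα).div_const (lam ^ τ)
  rw [korobovTrace, ← tsum_div_const]
  exact (Summable.of_nonneg_of_le (fun h => div_nonneg (rInv_nonneg hγ h)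
    (by linarith [rInv_nonneg (α := α) hγ h])) hle hs).tsum_le_tsum hle hs

end Trace

/-! ### Constants and assembly. -/

section Main

variable {α δ τ : ℝ} {γ : Finset ℕ → ℝ}

/-- The exponent `min(1, 1/(α - 4δ))` of the lattice estimate. -/
def latticeExponent (α δ : ℝ) : ℝ := min 1 (1 / (α - 4 * δ))

/-- The constant in the estimate of the lattice quality. -/
def latticeConst (α δ : ℝ) (γ : Finset ℕ → ℝ) (d : ℕ) : ℝ :=
  ((2 + 2 * residueConst (α * latticeExponent α δ))
    * korobovTrace α γ (latticeExponent α δ) d ^ 2 + 1) ^ (1 / (2 * latticeExponent α δ))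

/-- The constant in the error bound. -/
def errorConst (α δ τ : ℝ) (γ : Finset ℕ → ℝ) (d : ℕ) : ℝ :=
  24 * latticeConst α δ γ d + 8 + 2 * korobovTrace α γ τ d

lemma latticeExponent_pos (hδα : δ < α / 4) : 0 < latticeExponent α δ :=
  lt_min one_pos (one_div_pos.2 (by linarith))

/-- The exponent `μ` needs `μ ≤ 1` for subadditivity and `αμ > 1` for summability. The minimum with
1 takes effect when `α - 4δ < 1`. -/
lemma one_lt_mul_latticeExponent (hα : 1 < α) (hδ : 0 < δ) (hδα : δ < α / 4) :
    1 < α * latticeExponent α δ := by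
  have h0 : 0 < α - 4 * δ := by linarith
  rw [latticeExponent]
  rcases min_choice 1 (1 / (α - 4 * δ)) with h | h <;> rw [h]
  · simpa using hα
  · rw [mul_one_div]
    exact (one_lt_div h0).2 (by linarith)

lemma latticeConst_pos (d : ℕ) : 0 < latticeConst α δ γ d := by
  have := residueConst_nonneg (α * latticeExponent α δ)
  unfold latticeConst
  positivity

lemma errorConst_pos (hγ : ∀ w, 0 ≤ γ w) (d : ℕ) : 0 < errorConst α δ τ γ d := by
  have h1 := latticeConst_pos (α := α) (δ := δ) (γ := γ) d
  have h2 := korobovTrace_nonneg (α := α) hγ τ d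
  unfold errorConst
  positivity

lemma exists_trade_off (hα : 1 < α) (hδ : 0 < δ) (hδα : δ < α / 4) (hγ : ∀ w, 0 ≤ γ w)
    {d N : ℕ} (hN : N.Prime) {z : Fin d → ℕ} (hz : IsCBC (rInv α γ) N z) :
    ∃ m : ℝ, 0 < m ∧ 1 / m + m * latticeQuality (rInv α γ) N z
      ≤ 2 * latticeConst α δ γ d * (1 / (N : ℝ) ^ (α / 2 - 2 * δ)) := by
  have hμ0 := latticeExponent_pos hδα
  have hαμ := one_lt_mul_latticeExponent hα hδ hδα
  have hB := latticeConst_pos (α := α) (δ := δ) (γ := γ) d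
  have hρ := fun h : Fin d → ℤ => rInv_nonneg (α := α) hγ h
  have hq := latticeQuality_rpow_le hρ (summable_rInv hγ hα) hμ0 (min_le_left _ _) hαμ
    (summable_rInv_rpow hγ hαμ) (rInv_update_rpow hγ _) hN hz
  have hq0 : 0 ≤ latticeQuality (rInv α γ) N z := by
    rw [latticeQuality_eq_sum hρ (summable_rInv hγ hα)]
    exact Finset.sum_nonneg fun s _ => cbcCriterion_nonneg hρ N s z
  have hN1 : (1 : ℝ) ≤ N := by exact_mod_cast hN.one_le
  have hN0 : (0 : ℝ) < N := by linarith
  set e := α / 2 - 2 * δ with he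
  have hE : (0 : ℝ) < (N : ℝ) ^ e := Real.rpow_pos_of_pos hN0 e
  set S := latticeQuality (rInv α γ) N z with hS
  have hmain : S ≤ latticeConst α δ γ d ^ 2 / ((N : ℝ) ^ e) ^ 2 := by
    have hR := residueConst_nonneg (α * latticeExponent α δ)
    unfold latticeConst
    set μ := latticeExponent α δ with hμ
    set G := (2 + 2 * residueConst (α * μ)) * korobovTrace α γ μ d ^ 2 + 1 with hG
    have hG0 : 0 < G := by positivity
    have h1 : S ^ μ ≤ G / N := by
      refine hq.trans ?_
      rw [div_mul_eq_mul_div]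
      refine div_le_div_of_nonneg_right ?_ hN0.le
      change _ * korobovTrace α γ μ d ^ 2 ≤ G
      linarith
    have h2 : S ≤ (G / N) ^ (1 / μ) := by
      have h3 := Real.rpow_le_rpow (Real.rpow_nonneg hq0 _) h1 (one_div_nonneg.2 hμ0.le)
      rwa [← Real.rpow_mul hq0, mul_one_div_cancel hμ0.ne', Real.rpow_one] at h3
    refine h2.trans ?_
    rw [Real.div_rpow hG0.le hN0.le, ← Real.rpow_two, ← Real.rpow_two, ← Real.rpow_mul hG0.le,
      ← Real.rpow_mul hN0.le]
    have h4 : 1 / (2 * μ) * 2 = 1 / μ := by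
      field_simp
    rw [h4]
    refine div_le_div_of_nonneg_left (Real.rpow_nonneg hG0.le _) (Real.rpow_pos_of_pos hN0 _) ?_
    refine Real.rpow_le_rpow_of_exponent_le hN1 ?_
    rw [le_div_iff₀ hμ0]
    have h5 : 0 < α - 4 * δ := by linarith
    calc e * 2 * μ = (α - 4 * δ) * μ := by rw [he]; ring
      _ ≤ (α - 4 * δ) * (1 / (α - 4 * δ)) := mul_le_mul_of_nonneg_left (min_le_right _ _) h5.le
      _ = 1 := mul_one_div_cancel h5.ne'
  set B := latticeConst α δ γ d with hBdef
  -- This `m` balances `1/m` against `m B²/N^{2e}`: both equal `B/N^e`.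
  refine ⟨(N : ℝ) ^ e / B, div_pos hE hB, ?_⟩
  have h6 := mul_le_mul_of_nonneg_left hmain (div_pos hE hB).le
  refine (add_le_add_right h6 _).trans (le_of_eq ?_)
  field_simp
  norm_num

/-- The error bounds for a given dimension. -/
lemma mise_le_errorConst (hα : 1 < α) (hδ : 0 < δ) (hδα : δ < α / 4) (hτα : 1 / α < τ)
    (hτ : τ ≤ 1) (hγ : ∀ w, 0 ≤ γ w) {d N M : ℕ} (hN : N.Prime) (hM : 1 ≤ M) {z : Fin d → ℕ}
    (hz : IsCBC (rInv α γ) N z) {lam : ℝ} (hlam : 0 < lam) {f : (Fin d → ℝ) → ℝ}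
    (hf0 : ∀ x, 0 ≤ f x) (hf1 : ∫ x in cube d, f x = 1) (hf : MemRKHS (rInv α γ) f)
    {Ω : Type*} [MeasurableSpace Ω] (P : Measure Ω) [IsProbabilityMeasure P]
    (Y : Fin M → Ω → Fin d → ℝ) (hY : IsSample P f Y) (fhat : Ω → (Fin d → ℝ) → ℝ)
    (hfhat : ∀ ω, IsEstimator (rInv α γ) N z lam (fun m => Y m ω) (fhat ω)) :
    mise P fhat f ≤ ENNReal.ofReal (errorConst α δ τ γ d *
        (rkhsNorm (rInv α γ) f ^ 2 * (1 / (N : ℝ) ^ (α / 2 - 2 * δ))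
          + lam * rkhsNorm (rInv α γ) f ^ 2 + l2Norm f / (M * lam ^ τ))) ∧
      (MemRKHS (fun h => rInv α γ h ^ 2) f →
        mise P fhat f ≤ ENNReal.ofReal (errorConst α δ τ γ d *
          (rkhsNorm (rInv α γ) f ^ 2 * (1 / (N : ℝ) ^ (α / 2 - 2 * δ))
            + lam ^ 2 * rkhsNorm (fun h => rInv α γ h ^ 2) f ^ 2 + l2Norm f / (M * lam ^ τ)))) := by
  have hα0 : 0 < α := by linarith
  have hτ0 : 0 < τ := (one_div_pos.2 hα0).trans hτα
  have hατ : 1 < α * τ := by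
    rw [div_lt_iff₀ hα0] at hτα
    linarith
  have hρ := fun h : Fin d → ℤ => rInv_nonneg (α := α) hγ h
  have hs := summable_rInv (d := d) hγ hα
  have hesymm := fun h : Fin d → ℤ => rInv_neg (α := α) (γ := γ) h
  obtain ⟨u, hu, huA, hmise⟩ := mise_le hρ hs hesymm hM z hlam hf0 hf1 hf P Y hY fhat hfhat
  obtain ⟨hb1, hb2⟩ := l2Inner_bias_le hρ hs hesymm hN.ne_zero z hf hlam hu huA
    (exists_trade_off hα hδ hδα hγ hN hz)
  have hB := latticeConst_pos (α := α) (δ := δ) (γ := γ) d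
  have hT := korobovTrace_nonneg (α := α) hγ τ d
  have hM0 : (0 : ℝ) < M := by exact_mod_cast hM
  have hlt : 0 < lam ^ τ := Real.rpow_pos_of_pos hlam τ
  -- Expand `∫ (f - 1)² ≥ 0` using `∫ f = 1`.
  have hl2 : 1 ≤ l2Norm f := by
    have hfc := hf.continuous
    have h1 : 0 ≤ ∫ x in cube d, (f x - 1) ^ 2 := integral_nonneg fun x => sq_nonneg _
    have h2 : ∫ x in cube d, (f x - 1) ^ 2 = (∫ x in cube d, f x ^ 2) - 1 := by
      have h3 : ∀ x, (f x - 1) ^ 2 = f x ^ 2 - (2 * f x - 1) := fun x => by ring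
      simp only [h3]
      rw [integral_sub (integrableOn_cube (by fun_prop)) (integrableOn_cube (by fun_prop)),
        integral_sub (integrableOn_cube (by fun_prop)) (integrableOn_cube (by fun_prop)),
        integral_const_mul, hf1]
      have h4 : ∫ _ in cube d, (1 : ℝ) = 1 := by
        rw [setIntegral_const, smul_eq_mul, mul_one, measureReal_def, cube, Real.volume_Icc_pi]
        simp
      rw [h4]
      norm_num
    exact Real.one_le_sqrt.2 (by linarith)
  have hvar : 1 / (M : ℝ) * ∑' h : Fin d → ℤ, rInv α γ h / (rInv α γ h + lam)
      ≤ korobovTrace α γ τ d * (l2Norm f / (M * lam ^ τ)) := by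
    calc _ ≤ 1 / (M : ℝ) * (korobovTrace α γ τ d / lam ^ τ) :=
          mul_le_mul_of_nonneg_left (tsum_div_add_le hγ hατ hτ0.le hτ hlam d) (by positivity)
      _ = korobovTrace α γ τ d * (1 / (M * lam ^ τ)) := by
          field_simp
      _ ≤ _ := by gcongr
  set V := l2Norm f / (M * lam ^ τ) with hV
  have hV0 : 0 ≤ V := by positivity
  have hK0 : 0 ≤ rkhsNorm (rInv α γ) f ^ 2 := sq_nonneg _
  set E := 1 / (N : ℝ) ^ (α / 2 - 2 * δ) with hE
  have hE0 : 0 ≤ E := by positivity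
  rw [← rkhsNorm_sq hρ] at hb1 hb2
  set K := rkhsNorm (rInv α γ) f ^ 2
  set B := latticeConst α δ γ d
  set T := korobovTrace α γ τ d
  have hBV : 0 ≤ B * V := mul_nonneg hB.le hV0
  have hBKE : 0 ≤ B * (K * E) := by positivity
  have hKE : 0 ≤ K * E := by positivity
  have hTKE : 0 ≤ T * (K * E) := by positivity
  -- The second bound is the costlier: the split doubles `6b` and `4λ²`, and `b` contains `2B`,
  -- which accounts for `24B` and `8`.
  unfold errorConst
  refine ⟨hmise.trans (ENNReal.ofReal_le_ofReal ?_), fun hf2 =>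
    hmise.trans (ENNReal.ofReal_le_ofReal ?_)⟩
  · have h1 : 0 ≤ lam * K := by positivity
    have h2 : 0 ≤ B * (lam * K) := by positivity
    have h3 : 0 ≤ T * (lam * K) := by positivity
    linarith
  · have hb := hb2 hf2
    rw [← rkhsNorm_sq fun h => sq_nonneg _] at hb
    set Kt := rkhsNorm (fun h => rInv α γ h ^ 2) f ^ 2 with hKt
    have hKt0 : 0 ≤ Kt := sq_nonneg _
    have h1 : 0 ≤ lam ^ 2 * Kt := by positivity
    have h2 : 0 ≤ B * (lam ^ 2 * Kt) := by positivity
    have h3 : 0 ≤ T * (lam ^ 2 * Kt) := by positivity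
    linarith

/-- Only the traces at `μ = min(1, 1/(α-4δ))` and at `τ` depend on `d`. When `μ = 1`, the bound at
`τ ≤ 1` carries over. -/
lemma errorConst_bounded (hδ : 0 < δ) (hδα : δ < α / 4) (hτα : 1 / α < τ)
    (hτ : τ ≤ 1) (hγ : ∀ w, 0 ≤ γ w) (h1 : TraceBounded α γ (1 / (α - 4 * δ)))
    (h2 : TraceBounded α γ τ) : ∃ B : ℝ, ∀ d, errorConst α δ τ γ d ≤ B := by
  have hα0 : 0 < α := by linarith
  have hατ : 1 < α * τ := by
    rw [div_lt_iff₀ hα0] at hτα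
    linarith
  have hμ : TraceBounded α γ (latticeExponent α δ) := by
    rw [latticeExponent]
    rcases min_choice 1 (1 / (α - 4 * δ)) with h | h <;> rw [h]
    · exact h2.mono hγ hα0 hατ hτ
    · exact h1
  obtain ⟨B1, hB1⟩ := hμ
  obtain ⟨B2, hB2⟩ := h2
  have hμ0 := latticeExponent_pos hδα
  have hR := residueConst_nonneg (α * latticeExponent α δ)
  refine ⟨24 * ((2 + 2 * residueConst (α * latticeExponent α δ)) * B1 ^ 2 + 1)
    ^ (1 / (2 * latticeExponent α δ)) + 8 + 2 * B2, fun d => ?_⟩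
  have ht := korobovTrace_nonneg (α := α) hγ (latticeExponent α δ) d
  have ht1 := hB1 d
  have ht2 := hB2 d
  unfold errorConst latticeConst
  gcongr

end Main

end

end KorobovDensity

theorem mainTheorem4 (α δ τ : ℝ) (hα : 1 < α) (hδ : 0 < δ) (hδα : δ < α / 4)
    (hτα : 1 / α < τ) (hτ : τ ≤ 1)
    (γ : Finset ℕ → ℝ) (hγ : ∀ w, 0 ≤ γ w) (hγ_empty : γ ∅ = 1) :
    ∃ C Ct : ℕ → ℝ,
      (∀ d, 0 < C d ∧ 0 < Ct d) ∧
      (∀ (d N M : ℕ), 1 ≤ d → N.Prime → 1 ≤ M →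
        ∀ z : Fin d → ℕ, KorobovDensity.IsCBC (KorobovDensity.rInv α γ) N z →
        ∀ lam : ℝ, 0 < lam →
        ∀ f : (Fin d → ℝ) → ℝ, (∀ x, 0 ≤ f x) → (∫ x in KorobovDensity.cube d, f x) = 1 →
        KorobovDensity.MemRKHS (KorobovDensity.rInv α γ) f →
        ∀ (Ω : Type u) [MeasurableSpace Ω] (P : MeasureTheory.Measure Ω)
          [MeasureTheory.IsProbabilityMeasure P] (Y : Fin M → Ω → Fin d → ℝ),
        KorobovDensity.IsSample P f Y →
        ∀ fhat : Ω → (Fin d → ℝ) → ℝ,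
        (∀ ω, KorobovDensity.IsEstimator (KorobovDensity.rInv α γ) N z lam
          (fun m => Y m ω) (fhat ω)) →
          KorobovDensity.mise P fhat f ≤ ENNReal.ofReal (C d *
            (KorobovDensity.rkhsNorm (KorobovDensity.rInv α γ) f ^ 2
                * (1 / (N : ℝ) ^ (α / 2 - 2 * δ))
              + lam * KorobovDensity.rkhsNorm (KorobovDensity.rInv α γ) f ^ 2
              + KorobovDensity.l2Norm f / (M * lam ^ τ))) ∧
          (KorobovDensity.MemRKHS (fun h => KorobovDensity.rInv α γ h ^ 2) f →
            KorobovDensity.mise P fhat f ≤ ENNReal.ofReal (Ct d *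
              (KorobovDensity.rkhsNorm (KorobovDensity.rInv α γ) f ^ 2
                  * (1 / (N : ℝ) ^ (α / 2 - 2 * δ))
                + lam ^ 2 * KorobovDensity.rkhsNorm
                    (fun h => KorobovDensity.rInv α γ h ^ 2) f ^ 2
                + KorobovDensity.l2Norm f / (M * lam ^ τ))))) ∧
      (KorobovDensity.WeightSummable α δ γ →
        (1 / (α - 4 * δ) ≤ τ ∨ KorobovDensity.TraceSummable α τ γ) →
        ∃ B : ℝ, ∀ d, C d ≤ B) ∧
      (KorobovDensity.WeightSummable (2 * α) δ (fun w => γ w ^ 2) →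
        (1 / (α - 2 * δ) ≤ τ ∨ KorobovDensity.TraceSummable α τ γ) →
        ∃ B : ℝ, ∀ d, Ct d ≤ B) := by
  open KorobovDensity in
  have hα0 : 0 < α := by linarith
  have h4 : 0 < α - 4 * δ := by linarith
  have h2 : 0 < α - 2 * δ := by linarith
  have hατ : 1 < α * τ := by
    rw [div_lt_iff₀ hα0] at hτα
    linarith
  refine ⟨errorConst α δ τ γ, errorConst α δ τ γ,
    fun d => ⟨errorConst_pos hγ d, errorConst_pos hγ d⟩, ?_, ?_, ?_⟩
  · intro d N M _ hN hM z hz lam hlam f hf0 hf1 hf Ω _ P _ Y hY fhat hfhat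
    exact mise_le_errorConst hα hδ hδα hτα hτ hγ hN hM hz hlam hf0 hf1 hf P Y hY fhat hfhat
  · intro hW hor
    have hαν : 1 < α * (1 / (α - 4 * δ)) := by
      rw [mul_one_div]
      exact (one_lt_div h4).2 (by linarith)
    have hB := (hW.traceSummable hγ hδ hδα).traceBounded hγ hαν
    refine errorConst_bounded hδ hδα hτα hτ hγ hB ?_
    rcases hor with h | h
    · exact hB.mono hγ hα0 hαν h
    · exact h.traceBounded hγ hατ
  · intro hW hor
    have hαν : 1 < α * (1 / (α - 2 * δ)) := by
      rw [mul_one_div]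
      exact (one_lt_div h2).2 (by linarith)
    -- The condition on the squared kernel becomes a trace condition on the original one at
    -- `1/(α-2δ)`. This exponent is smaller than `1/(α-4δ)`, so monotonicity yields the bound needed
    -- for the lattice.
    have hS := (hW.traceSummable (fun w => sq_nonneg _) hδ (by linarith)).of_sq hγ
    have hexp : 2 * (1 / (2 * α - 4 * δ)) = 1 / (α - 2 * δ) := by
      rw [show 2 * α - 4 * δ = 2 * (α - 2 * δ) by ring]
      field_simp
    rw [hexp] at hS
    have hB := hS.traceBounded hγ hαν
    refine errorConst_bounded hδ hδα hτα hτ hγ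
      (hB.mono hγ hα0 hαν (one_div_le_one_div_of_le h4 (by linarith))) ?_
    rcases hor with h | h
    · exact hB.mono hγ hα0 hαν h
    · exact h.traceBounded hγ hατ
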